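/- Let $\Gamma$ be a finitely generated group with a finite symmetric generating set $S$, and let $|\gamma|$ denote the word length of $\gamma\in\Gamma$ with respect to $S$. Let $\lambda\colon\Gamma\to\mathcal B(\ell^2(\Gamma))$ be the left regular representation and $\tau(a)=\langle a\delta_e,\delta_e\rangle$; we extend $\lambda$ linearly to $\mathbf C[\Gamma]$. For each positive integer $N$ let $\phi_N\colon\Gamma\to\mathrm{Sym}(N)$ be a uniformly random homomorphism, and let $\pi_N=\mathrm{std}\circ\phi_N$, where $\mathrm{std}$ is the restriction of the permutation representation of $\mathrm{Sym}(N)$ on $\mathbf C^N$ to the hyperplane orthogonal to the all-ones vector; we extend $\pi_N$ linearly to $\mathbf C[\Gamma]$. Write $\mathrm{ntr}(\pi_N(\gamma))=\mathrm{tr}(\pi_N(\gamma))/N$. Let $\mu$ be a positive integer, and let $u_k\colon\Gamma\to\mathbf R$ $(k=0,1,2,\dots)$ be functions satisfying the following two requirements. (1) (Asymptotic expansion.) $u_0(\gamma)=\tau(\lambda(\gamma))$ for every $\gamma\in\Gamma$, and there is a constant $C\ge 1$ such that for every $\gamma\in\Gamma$, every positive integer $s\ge|\gamma|$ and every integer $N\ge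 Cs^C$, $$\left|\mathbf E[\mathrm{ntr}\,\pi_N(\gamma)]-\sum_{k=0}^{s-1}\frac{u_k(\gamma)}{N^{k/\mu}}\right|\le\frac{(Cs)^{Cs}}{N^{s/\mu}}.$$ (2) (Temperedness.) Extend each $u_k$ linearly to $\mathbf C[\Gamma]$. For every integer $k$ with $1\le k\le\mu$ and every self-adjoint $x\in\mathbf C[\Gamma]$ (that is, $x=x^*$ for the involution $(\sum_\gamma a_\gamma\gamma)^*=\sum_\gamma\overline{a_\gamma}\gamma^{-1}$), $$\limsup_{p\to\infty}|u_k(x^p)|^{1/p}\le\|\lambda(x)\|.$$ Then for every $x\in\mathbf C[\Gamma]$ there is a sequence of real numbers $\varepsilon_N\to 0$ such that $$\mathbf P\big[\,\|\pi_N(x)\|>\|\lambda(x)\|+\varepsilon_N\,\big]=O\big(N^{-1/(2\mu)}\big)\qquad(N\to\infty).$$ In particular, $\|\pi_N(x)\|\le\|\lambda(x)\|+o(1)$ with high probability as $N\to\infty$. -/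

import Mathlib

open Filter Topology Asymptotics
open scoped ENNReal

noncomputable section

namespace StrongUpperBound

/-! ### Generating sets and word length -/

/-- The finite set `S` is a symmetric generating set of the group `Γ`. -/
def IsSymmGenSet {Γ : Type*} [Group Γ] (S : Finset Γ) : Prop :=
  (∀ s ∈ S, s⁻¹ ∈ S) ∧ Subgroup.closure (S : Set Γ) = ⊤

/-- The word length of `γ` with respect to `S`: the least number of factors in an expression of `γ`
as a product of elements of `S`. -/
def wordLength {Γ : Type*} [Group Γ] (S : Finset Γ) (γ : Γ) : ℕ :=
  sInf {n | ∃ l : List Γ, l.length = n ∧ (∀ s ∈ l, s ∈ S) ∧ l.prod = γ}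

/-! ### The left regular representation -/

/-- The Hilbert space `ℓ²(Γ)`. -/
abbrev EllTwo (Γ : Type*) : Type _ := lp (fun _ : Γ => ℂ) 2

theorem memlp_translate {Γ : Type*} [Group Γ] (γ : Γ) (f : EllTwo Γ) :
    Memℓp (fun x : Γ => f (γ⁻¹ * x)) 2 := by
  have h := (lp.memℓp f).summable (by norm_num)
  refine memℓp_gen ?_
  exact ((Equiv.mulLeft γ⁻¹).summable_iff (f := fun x => ‖f x‖ ^ (2 : ℝ≥0∞).toReal)).2 h

/-- Left translation on `ℓ²(Γ)`: `(λ(γ) f)(x) = f (γ⁻¹ x)`. -/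
def leftTranslate {Γ : Type*} [Group Γ] (γ : Γ) : EllTwo Γ →ₗᵢ[ℂ] EllTwo Γ where
  toFun f := ⟨fun x : Γ => f (γ⁻¹ * x), memlp_translate γ f⟩
  map_add' f g := by ext x; rfl
  map_smul' c f := by ext x; rfl
  norm_map' f := by
    rw [lp.norm_eq_tsum_rpow (by norm_num), lp.norm_eq_tsum_rpow (by norm_num)]
    congr 1
    exact (Equiv.mulLeft γ⁻¹).tsum_eq (fun x => ‖f x‖ ^ (2 : ℝ≥0∞).toReal)

/-- The left regular representation `λ : Γ → B(ℓ²(Γ))`. -/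
def leftRegular (Γ : Type*) [Group Γ] : Γ →* (EllTwo Γ →L[ℂ] EllTwo Γ) where
  toFun γ := (leftTranslate γ).toContinuousLinearMap
  map_one' := by
    ext f x
    change f (1⁻¹ * x) = f x
    simp
  map_mul' a b := by
    ext f x
    change f ((a * b)⁻¹ * x) = f (b⁻¹ * (a⁻¹ * x))
    simp [mul_assoc]

/-- The linear extension of the left regular representation to `ℂ[Γ]`. -/
def leftRegularAlg (Γ : Type*) [Group Γ] :
    MonoidAlgebra ℂ Γ →ₐ[ℂ] (EllTwo Γ →L[ℂ] EllTwo Γ) :=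
  MonoidAlgebra.lift ℂ (EllTwo Γ →L[ℂ] EllTwo Γ) Γ (leftRegular Γ)

open Classical in
/-- The canonical trace `τ(a) = ⟨a δ_e, δ_e⟩` on operators on `ℓ²(Γ)`
(Mathlib's inner product is linear in its second argument). -/
def canonicalTrace {Γ : Type*} [Group Γ] (a : EllTwo Γ →L[ℂ] EllTwo Γ) : ℂ :=
  inner ℂ (lp.single 2 (1 : Γ) (1 : ℂ)) (a (lp.single 2 (1 : Γ) (1 : ℂ)))

/-! ### The standard representation of the symmetric group -/

/-- The hyperplane of `ℂ^N` orthogonal to the all-ones vector. -/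
abbrev StdSpace (N : ℕ) : Submodule ℂ (EuclideanSpace ℂ (Fin N)) :=
  (ℂ ∙ (WithLp.toLp 2 fun _ => 1 : EuclideanSpace ℂ (Fin N)))ᗮ

/-- The action of a permutation on `ℂ^N` by permuting the basis vectors, `σ e_i = e_{σ(i)}`. -/
def permOp {N : ℕ} (σ : Equiv.Perm (Fin N)) :
    EuclideanSpace ℂ (Fin N) →L[ℂ] EuclideanSpace ℂ (Fin N) :=
  (LinearIsometryEquiv.piLpCongrLeft 2 ℂ ℂ σ).toContinuousLinearEquiv.toContinuousLinearMap

theorem permOp_apply {N : ℕ} (σ : Equiv.Perm (Fin N)) (v : EuclideanSpace ℂ (Fin N))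
    (i : Fin N) : permOp σ v i = v (σ⁻¹ i) := rfl

theorem permOp_mem {N : ℕ} (σ : Equiv.Perm (Fin N)) :
    ∀ v ∈ StdSpace N, permOp σ v ∈ StdSpace N := by
  intro v hv
  rw [Submodule.mem_orthogonal_singleton_iff_inner_right] at hv ⊢
  simp only [PiLp.inner_apply, permOp_apply] at hv ⊢
  rw [← hv]
  exact Equiv.sum_comp σ⁻¹ (fun i => inner ℂ (1 : ℂ) (v i))

/-- The standard representation `std` of `Sym(N)`: the restriction of the permutation
representation on `ℂ^N` to the hyperplane orthogonal to the all-ones vector. -/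
def std (N : ℕ) : Equiv.Perm (Fin N) →* (StdSpace N →L[ℂ] StdSpace N) where
  toFun σ := (permOp σ).restrict (permOp_mem σ)
  map_one' := by
    ext v i
    rfl
  map_mul' a b := by
    ext v i
    rfl

/-- The representation `π = std ∘ φ` of `Γ` attached to a homomorphism `φ : Γ → Sym(N)`. -/
def stdRep {Γ : Type*} [Group Γ] {N : ℕ} (φ : Γ →* Equiv.Perm (Fin N)) :
    Γ →* (StdSpace N →L[ℂ] StdSpace N) :=
  (std N).comp φ

/-- The linear extension of `π = std ∘ φ` to `ℂ[Γ]`. -/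
def stdRepAlg {Γ : Type*} [Group Γ] {N : ℕ} (φ : Γ →* Equiv.Perm (Fin N)) :
    MonoidAlgebra ℂ Γ →ₐ[ℂ] (StdSpace N →L[ℂ] StdSpace N) :=
  MonoidAlgebra.lift ℂ (StdSpace N →L[ℂ] StdSpace N) Γ (stdRep φ)

/-- The normalized trace `tr(a) / N` of an operator on the `(N-1)`-dimensional space `StdSpace N`.
The normalization is by `N`. -/
def ntr {N : ℕ} (a : StdSpace N →L[ℂ] StdSpace N) : ℂ :=
  LinearMap.trace ℂ (StdSpace N) (a : StdSpace N →ₗ[ℂ] StdSpace N) / (N : ℂ)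

/-! ### Uniformly random homomorphisms to the symmetric group -/

instance finite_hom (Γ : Type*) [Group Γ] [Group.FG Γ] (N : ℕ) :
    Finite (Γ →* Equiv.Perm (Fin N)) := by
  obtain ⟨T, hT⟩ := Group.fg_def.1 (inferInstance : Group.FG Γ)
  refine Finite.of_injective
    (fun φ : Γ →* Equiv.Perm (Fin N) => fun t : T => φ t) ?_
  intro φ ψ h
  refine MonoidHom.eq_of_eqOn_dense hT ?_
  intro t ht
  exact congrFun h ⟨t, ht⟩

instance fintype_hom (Γ : Type*) [Group Γ] [Group.FG Γ] (N : ℕ) :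
    Fintype (Γ →* Equiv.Perm (Fin N)) := Fintype.ofFinite _

/-- The expectation of `X φ` for a uniformly random homomorphism `φ : Γ → Sym(N)`. -/
def expectHom {Γ : Type*} [Group Γ] [Group.FG Γ] {N : ℕ}
    (X : (Γ →* Equiv.Perm (Fin N)) → ℂ) : ℂ :=
  (∑ φ : Γ →* Equiv.Perm (Fin N), X φ) / (Fintype.card (Γ →* Equiv.Perm (Fin N)) : ℂ)

/-- The probability that `A φ` holds for a uniformly random homomorphism `φ : Γ → Sym(N)`. -/
def probHom {Γ : Type*} [Group Γ] [Group.FG Γ] {N : ℕ}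
    (A : (Γ →* Equiv.Perm (Fin N)) → Prop) : ℝ :=
  (Nat.card {φ : Γ →* Equiv.Perm (Fin N) // A φ} : ℝ) /
    (Nat.card (Γ →* Equiv.Perm (Fin N)) : ℝ)

/-! ### The two requirements -/

/-- The functions `u k : Γ → ℝ`, `k = 0, 1, 2, …`, are the coefficients of an asymptotic expansion
of the expected normalized trace `E[ntr π_N(γ)]` in powers of `N^{-1/μ}`: one has
`u 0 γ = τ(λ(γ))`, and there is a constant `C ≥ 1` such that for every `γ ∈ Γ`, every integer
`s ≥ 1` with `s ≥ |γ|` and every integer `N ≥ C s^C`, the expansion truncated after `s` terms has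
an error of at most `(C s)^{C s} / N^{s/μ}`. -/
def HasTraceExpansion {Γ : Type*} [Group Γ] [Group.FG Γ] (S : Finset Γ) (μ : ℕ)
    (u : ℕ → Γ → ℝ) : Prop :=
  (∀ γ : Γ, (u 0 γ : ℂ) = canonicalTrace (leftRegular Γ γ)) ∧
  ∃ C : ℝ, 1 ≤ C ∧ ∀ γ : Γ, ∀ s : ℕ, 1 ≤ s → wordLength S γ ≤ s →
    ∀ N : ℕ, C * (s : ℝ) ^ C ≤ (N : ℝ) →
      ‖expectHom (fun φ : Γ →* Equiv.Perm (Fin N) => ntr (stdRep φ γ)) -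
          ((∑ k ∈ Finset.range s, u k γ / (N : ℝ) ^ ((k : ℝ) / (μ : ℝ)) : ℝ) : ℂ)‖ ≤
        (C * s) ^ (C * s) / (N : ℝ) ^ ((s : ℝ) / (μ : ℝ))

/-- The linear extension to `ℂ[Γ]` of a real function on `Γ`. -/
def linExt {Γ : Type*} [Group Γ] (v : Γ → ℝ) : MonoidAlgebra ℂ Γ →ₗ[ℂ] ℂ :=
  Finsupp.linearCombination ℂ (fun γ => (v γ : ℂ)) ∘ₗ
    (MonoidAlgebra.coeffLinearEquiv ℂ).toLinearMap

/-- Self-adjointness in `ℂ[Γ]` for the involution `(∑ a_γ γ)^* = ∑ conj(a_γ) γ⁻¹`. -/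
def IsSelfAdj {Γ : Type*} [Group Γ] (x : MonoidAlgebra ℂ Γ) : Prop :=
  ∀ γ : Γ, x.coeff γ⁻¹ = star (x.coeff γ)

/-- The functional `v` on `ℂ[Γ]` is tempered at `x`: `limsup_p |v(x^p)|^{1/p} ≤ ‖λ(x)‖`,
the limsup being taken in `[0, ∞]`. -/
def IsTemperedAt {Γ : Type*} [Group Γ] (v : MonoidAlgebra ℂ Γ →ₗ[ℂ] ℂ)
    (x : MonoidAlgebra ℂ Γ) : Prop :=
  limsup (fun p : ℕ => ‖v (x ^ p)‖ₑ ^ (1 / (p : ℝ))) atTop ≤ ‖leftRegularAlg Γ x‖ₑ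

end StrongUpperBound

end

noncomputable section

namespace StrongUpperBound

/-! By the C*-identity for `involution x * x` one may assume x self-adjoint, and by a diagonal
argument it suffices to bound P[‖π_N(x)‖ > a] for each fixed a > ‖λ(x)‖. Fix r with ‖λ(x)‖ < r < a.
`exists_cutoff_polynomial` gives a polynomial f with values in [0,1] on an interval containing every
possible eigenvalue of π_N(x), at least 1/2 there once |t| ≥ a, and with coefficient norm at r below
a tiny θ. Temperedness then yields |u_k(f(x)^L)| ≤ c_k θ^L for k ≤ μ (`norm_map_aeval_le`). If
‖π_N(x)‖ > a, then tr f(π_N(x))^L ≥ 2^{-L}, so the probability is at most 2^L N E[ntr f(π_N(x))^L]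
(`exists_expectNtr_eq`).

The expectation is compared with its expansion by the polynomial method. For fixed L it is, up to a
small error, a polynomial of degree < s in M^{-1/μ}, and it lies in [0,1] for every M. Markov-type
inequalities convert boundedness at these closely spaced points into bounds on the coefficients, so
truncating after k = μ costs only (Q N^{-1/μ})^{μ+1} up to a constant, with Q polynomial in s
(`abs_sub_truncation_le`).

Finally L is about log N/(8μ). Then s and Q are polylogarithmic, 2^L ≤ 2N^{1/(8μ)} and θ^L ≤ N^{-2}.
The bound is N^{-7/(8μ)} up to logarithms, hence below N^{-1/(2μ)} (`eventually_error_le`). -/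

/-! ### Markov-type inequalities for real polynomials -/

open Polynomial in
theorem eval_iterate_derivative_T_one_le (n k : ℕ) :
    (derivative^[k] (Chebyshev.T ℝ n)).eval 1 ≤ (n : ℝ) ^ (2 * k) := by
  have key : ∀ k : ℕ, 0 ≤ (derivative^[k] (Chebyshev.T ℝ n)).eval 1 ∧
      (derivative^[k] (Chebyshev.T ℝ n)).eval 1 ≤ (n : ℝ) ^ (2 * k) := by
    intro k
    induction k with
    | zero => simp
    | succ k ih =>
      have h := Chebyshev.iterate_derivative_T_eval_one_recurrence (R := ℝ) n k
      push_cast at h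
      -- The recurrence multiplies by (n² - k²)/(2k + 1), which lies in [0, n²] for k ≤ n; beyond
      -- that the derivative vanishes.
      rcases le_or_gt k n with hk | hk
      · have hk' : (k : ℝ) ≤ n := by exact_mod_cast hk
        have hsq : (0 : ℝ) ≤ n ^ 2 - k ^ 2 := by nlinarith [(Nat.cast_nonneg k : (0 : ℝ) ≤ k)]
        have hrhs : 0 ≤ ((n : ℝ) ^ 2 - k ^ 2) * (derivative^[k] (Chebyshev.T ℝ n)).eval 1 :=
          mul_nonneg hsq ih.1
        have hpos : (0 : ℝ) < 2 * k + 1 := by positivity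
        have h0 : 0 ≤ (derivative^[k + 1] (Chebyshev.T ℝ n)).eval 1 := by
          rw [← h] at hrhs
          exact nonneg_of_mul_nonneg_right hrhs hpos
        refine ⟨h0, ?_⟩
        calc (derivative^[k + 1] (Chebyshev.T ℝ n)).eval 1
            ≤ (2 * k + 1) * (derivative^[k + 1] (Chebyshev.T ℝ n)).eval 1 := by
              nlinarith [(Nat.cast_nonneg k : (0 : ℝ) ≤ k)]
          _ = ((n : ℝ) ^ 2 - k ^ 2) * (derivative^[k] (Chebyshev.T ℝ n)).eval 1 := h
          _ ≤ (n : ℝ) ^ 2 * (n : ℝ) ^ (2 * k) :=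
              mul_le_mul (by nlinarith [sq_nonneg (k : ℝ)]) ih.2 ih.1 (by positivity)
          _ = (n : ℝ) ^ (2 * (k + 1)) := by ring
      · rw [iterate_derivative_eq_zero_of_degree_lt]
        · simp
        · rw [Chebyshev.degree_T]; simp; exact_mod_cast (by omega)
  exact (key k).2

open Polynomial in
/-- A form of the Markov brothers' inequality at an endpoint of an interval. -/
theorem abs_eval_iterate_derivative_le {P : ℝ[X]} {n : ℕ} (hP : P.natDegree ≤ n) {a b B : ℝ}
    (hab : a ≠ b) (hB : 0 < B) (hbd : ∀ x ∈ Set.uIcc a b, |P.eval x| ≤ B) (k : ℕ) :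
    |(derivative^[k] P).eval a| ≤ B * (2 * n ^ 2 / |a - b|) ^ k := by
  -- The affine map `l` sends 1 to a and -1 to b, so the extremality of Chebyshev derivatives at 1
  -- transfers to the endpoint a.
  set c : ℝ := (a - b) / 2 with hc
  have hc0 : c ≠ 0 := by
    rw [hc]; exact div_ne_zero (sub_ne_zero.2 hab) two_ne_zero
  set l : ℝ[X] := C c * X + C ((a + b) / 2) with hl
  have hiter : ∀ k : ℕ, derivative^[k] (P.comp l) = C (c ^ k) * (derivative^[k] P).comp l := by
    intro k
    induction k with
    | zero => simp
    | succ k ih =>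
      rw [Function.iterate_succ_apply', ih, Function.iterate_succ_apply', derivative_C_mul,
        derivative_comp]
      have : derivative l = C c := by simp [hl]
      rw [this, pow_succ, C_mul]
      ring
  have hl1 : l.eval 1 = a := by simp [hl, hc]; ring
  have key : ∀ σ : ℝ, |σ| = 1 → σ * c ^ k * (derivative^[k] P).eval a ≤ B * (n : ℝ) ^ (2 * k) := by
    intro σ hσ
    have h := Chebyshev.eval_iterate_derivative_le_of_forall_abs_le_one (n := n) (k := k)
      (P := C (σ / B) * P.comp l) (x := 1) le_rfl ?_ ?_
    · rw [iterate_derivative_C_mul, hiter, eval_mul, eval_mul, eval_C, eval_C, eval_comp, hl1] at h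
      have h2 := h.trans (eval_iterate_derivative_T_one_le n k)
      rw [div_mul_eq_mul_div, div_le_iff₀ hB] at h2
      linarith
    · refine degree_le_of_natDegree_le ((natDegree_C_mul_le _ _).trans (natDegree_comp_le.trans ?_))
      have : l.natDegree ≤ 1 := by rw [hl]; compute_degree
      nlinarith
    · intro x hx
      have hmem : l.eval x ∈ Set.uIcc a b := by
        have h1 : l.eval x = ((1 + x) / 2) * a + ((1 - x) / 2) * b := by simp [hl, hc]; ring
        rw [h1, ← segment_eq_uIcc]
        exact ⟨(1 + x) / 2, (1 - x) / 2, by linarith [hx.1], by linarith [hx.2], by ring, by simp⟩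
      rw [eval_mul, eval_C, eval_comp, abs_mul, abs_div, hσ, abs_of_pos hB, div_mul_eq_mul_div,
        one_mul, div_le_one hB]
      exact hbd _ hmem
  have habs : |c ^ k * (derivative^[k] P).eval a| ≤ B * (n : ℝ) ^ (2 * k) := by
    refine abs_le.2 ⟨?_, ?_⟩
    · have := key (-1) (by simp); linarith
    · have := key 1 (by simp); linarith
  have hcpos : 0 < |c| := abs_pos.2 hc0
  rw [abs_mul, abs_pow, mul_comm, ← le_div_iff₀ (by positivity)] at habs
  refine habs.trans (le_of_eq ?_)
  have h2 : |a - b| = 2 * |c| := by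
    rw [hc, abs_div, abs_two]; ring
  rw [h2, mul_div_mul_left _ _ two_ne_zero, div_pow, ← pow_mul, mul_div_assoc]

-- The k-th coefficient is the k-th derivative at the endpoint 0 divided by k!; the gain from k! is
-- discarded.
open Polynomial in
theorem abs_coeff_le_of_bounded {P : ℝ[X]} {n : ℕ} (hP : P.natDegree ≤ n) {τ B : ℝ}
    (hτ : 0 < τ) (hB : 0 < B) (hbd : ∀ x ∈ Set.Icc 0 τ, |P.eval x| ≤ B) (k : ℕ) :
    |P.coeff k| ≤ B * (2 * n ^ 2 / τ) ^ k := by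
  have h := abs_eval_iterate_derivative_le hP (a := 0) (b := τ) hτ.ne hB
    (by rwa [Set.uIcc_of_le hτ.le]) k
  rw [zero_sub, abs_neg, abs_of_pos hτ, ← coeff_zero_eq_eval_zero, coeff_iterate_derivative] at h
  simp only [zero_add, Nat.descFactorial_self, nsmul_eq_mul, abs_mul, Nat.abs_cast] at h
  refine le_trans ?_ h
  exact le_mul_of_one_le_left (abs_nonneg _) (by exact_mod_cast Nat.one_le_iff_ne_zero.2 k.factorial_ne_zero)

-- Each x is an endpoint of a subinterval of length at least τ/2, reaching to the farther end of [0,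
-- τ], so the endpoint inequality applies with twice the constant.
open Polynomial in
theorem abs_eval_derivative_le_of_bounded {P : ℝ[X]} {n : ℕ} (hP : P.natDegree ≤ n) {τ B : ℝ}
    (hτ : 0 < τ) (hB : 0 < B) (hbd : ∀ x ∈ Set.Icc 0 τ, |P.eval x| ≤ B) {x : ℝ}
    (hx : x ∈ Set.Icc 0 τ) :
    |(derivative P).eval x| ≤ B * (4 * n ^ 2 / τ) := by
  obtain ⟨c, hc, hcx⟩ : ∃ c ∈ Set.Icc 0 τ, τ / 2 ≤ |x - c| := by
    rcases le_total x (τ / 2) with h | h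
    · exact ⟨τ, ⟨hτ.le, le_rfl⟩, by rw [abs_sub_comm]; exact le_trans (by linarith) (le_abs_self _)⟩
    · exact ⟨0, ⟨le_rfl, hτ.le⟩, by simpa using h.trans (le_abs_self x)⟩
  have hne : x ≠ c := by
    rintro rfl; simp at hcx; linarith
  have h := abs_eval_iterate_derivative_le hP hne hB
    (fun y hy => hbd y (Set.ordConnected_Icc.uIcc_subset hx hc hy)) 1
  simp only [Function.iterate_one, pow_one] at h
  refine h.trans (mul_le_mul_of_nonneg_left ?_ hB.le)
  calc 2 * (n : ℝ) ^ 2 / |x - c| ≤ 2 * (n : ℝ) ^ 2 / (τ / 2) :=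
        div_le_div_of_nonneg_left (by positivity) (by positivity) hcx
    _ = 4 * n ^ 2 / τ := by field_simp; ring

/-! ### The sample points `N^{-1/μ}` -/

/-- The point `N^{-1/μ}`. -/
def rootInv (μ N : ℕ) : ℝ := ((N : ℝ) ^ (1 / (μ : ℝ)))⁻¹

theorem rootInv_pos (μ : ℕ) {N : ℕ} (hN : 0 < N) : 0 < rootInv μ N := by
  unfold rootInv; positivity

theorem rootInv_pow (μ N k : ℕ) : rootInv μ N ^ k = ((N : ℝ) ^ ((k : ℝ) / (μ : ℝ)))⁻¹ := by
  rw [rootInv, inv_pow, ← Real.rpow_natCast, ← Real.rpow_mul (Nat.cast_nonneg N)]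
  congr 2; ring

theorem rootInv_anti (μ : ℕ) {M N : ℕ} (hM : 0 < M) (h : M ≤ N) : rootInv μ N ≤ rootInv μ M := by
  unfold rootInv
  have : (0 : ℝ) < M := by exact_mod_cast hM
  have h' : (M : ℝ) ≤ N := by exact_mod_cast h
  gcongr

theorem tendsto_rootInv {μ : ℕ} (hμ : 1 ≤ μ) : Tendsto (rootInv μ) atTop (𝓝 0) :=
  ((tendsto_rpow_atTop (by positivity)).comp tendsto_natCast_atTop_atTop).inv_tendsto_atTop

/-- Since 1/μ ≤ 1, the ratio ((M+1)/M)^{1/μ} is at most (M+1)/M, so consecutive points differ by a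
relative amount of at most 1/M. -/
theorem rootInv_sub_le {μ : ℕ} (hμ : 1 ≤ μ) {M : ℕ} (hM : 0 < M) :
    rootInv μ M - rootInv μ (M + 1) ≤ rootInv μ M / M := by
  have hM' : (0 : ℝ) < M := by exact_mod_cast hM
  have h1 : ((M + 1 : ℕ) : ℝ) ^ (1 / (μ : ℝ)) ≤ (M : ℝ) ^ (1 / (μ : ℝ)) * ((M + 1) / M) := by
    have : ((M + 1 : ℕ) : ℝ) = M * ((M + 1) / M) := by push_cast; field_simp
    rw [this, Real.mul_rpow hM'.le (by positivity)]
    refine mul_le_mul_of_nonneg_left ?_ (by positivity)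
    have h2 : (1 : ℝ) ≤ (M + 1) / M := by rw [one_le_div hM']; linarith
    conv_rhs => rw [← Real.rpow_one (((M : ℝ) + 1) / M)]
    refine Real.rpow_le_rpow_of_exponent_le h2 ?_
    rw [div_le_one (by positivity)]; exact_mod_cast hμ
  have hx : 0 < (M : ℝ) ^ (1 / (μ : ℝ)) := by positivity
  have h3 : ((M : ℝ) ^ (1 / (μ : ℝ)) * ((M + 1) / M))⁻¹ ≤ rootInv μ (M + 1) := by
    unfold rootInv
    exact inv_anti₀ (by positivity) h1
  have h4 : ((M : ℝ) ^ (1 / (μ : ℝ)) * ((M + 1) / M))⁻¹ = rootInv μ M * (M / (M + 1)) := by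
    unfold rootInv; field_simp
  rw [h4] at h3
  have h5 : rootInv μ M * (1 - M / (M + 1)) ≤ rootInv μ M * (1 / M) := by
    refine mul_le_mul_of_nonneg_left ?_ (rootInv_pos μ hM).le
    have : (1 : ℝ) - M / (M + 1) = 1 / (M + 1) := by field_simp; ring
    rw [this]
    exact div_le_div_of_nonneg_left zero_le_one hM' (by linarith)
  rw [mul_one_div] at h5
  linarith

/-- The least M ≥ M₀ whose successor point falls below t traps t in one gap, and the bound on gaps
decreases in M. -/
theorem exists_rootInv_near {μ : ℕ} (hμ : 1 ≤ μ) {M₀ : ℕ} (hM₀ : 0 < M₀) {t : ℝ}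
    (ht : 0 < t) (ht' : t ≤ rootInv μ M₀) :
    ∃ M, M₀ ≤ M ∧ |t - rootInv μ M| ≤ rootInv μ M₀ / M₀ := by
  have hex : ∃ M, M₀ ≤ M ∧ rootInv μ (M + 1) < t := by
    have h := ((tendsto_rootInv hμ).comp (tendsto_add_atTop_nat 1)).eventually_lt_const ht
    obtain ⟨M, hM, hlt⟩ := ((eventually_ge_atTop M₀).and h).exists
    exact ⟨M, hM, hlt⟩
  classical
  obtain ⟨h1, h2⟩ := Nat.find_spec hex
  set M := Nat.find hex with hM
  have h3 : t ≤ rootInv μ M := by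
    rcases h1.eq_or_lt with h | h
    · rw [← h]; exact ht'
    · by_contra hcon
      push Not at hcon
      refine Nat.find_min hex (m := M - 1) (by omega) ⟨by omega, ?_⟩
      rwa [Nat.sub_add_cancel (by omega)]
  refine ⟨M, h1, ?_⟩
  have hMpos : 0 < M := by omega
  have h4 := rootInv_sub_le hμ hMpos
  have h5 : rootInv μ M / M ≤ rootInv μ M₀ / M₀ :=
    div_le_div₀ (rootInv_pos μ hM₀).le (rootInv_anti μ hM₀ h1) (by exact_mod_cast hM₀)
      (by exact_mod_cast h1)
  rw [abs_sub_comm, abs_of_nonneg (by linarith)]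
  linarith

/-! ### From bounds at sample points to truncation of the expansion -/

open Polynomial in
/-- A polynomial bounded at the points `M^{-1/μ}`, `M ≥ M₀`, is bounded on `[0, M₀^{-1/μ}]` once
`M₀` is large compared to the square of the degree. -/
theorem abs_eval_le_of_bounded_rootInv {P : ℝ[X]} {n μ : ℕ} (hP : P.natDegree ≤ n) (hμ : 1 ≤ μ)
    {M₀ : ℕ} (hM₀ : 0 < M₀) (hn : 8 * n ^ 2 ≤ M₀) {B : ℝ} (hB : 0 < B)
    (hbd : ∀ M, M₀ ≤ M → |P.eval (rootInv μ M)| ≤ B) :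
    ∀ x ∈ Set.Icc 0 (rootInv μ M₀), |P.eval x| ≤ 2 * B := by
  set τ := rootInv μ M₀ with hτ
  have hτ0 : 0 < τ := rootInv_pos μ hM₀
  obtain ⟨z, hz, hmax⟩ := isCompact_Icc.exists_isMaxOn (Set.nonempty_Icc.2 hτ0.le)
    (P.continuous.abs.continuousOn (s := Set.Icc 0 τ))
  set D := |P.eval z| with hD
  have hle : ∀ x ∈ Set.Icc 0 τ, |P.eval x| ≤ D := fun x hx => hmax hx
  have hτB : B ≤ 2 * B := by linarith
  suffices D ≤ 2 * B from fun x hx => (hle x hx).trans this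
  by_contra hcon
  push Not at hcon
  have hDpos : 0 < D := by linarith
  -- The maximum D controls the derivative by 4n²D/τ, and some sample point lies within τ/M₀ of t.
  -- As 8n² ≤ M₀, moving there costs at most D/2. At the maximizer this gives D ≤ B + D/2.
  have key : ∀ t ∈ Set.Ioc 0 τ, |P.eval t| ≤ B + D / 2 := by
    intro t ht
    obtain ⟨M, hM, hMt⟩ := exists_rootInv_near hμ hM₀ ht.1 ht.2
    have hmem : rootInv μ M ∈ Set.Icc 0 τ :=
      ⟨(rootInv_pos μ (by omega)).le, rootInv_anti μ hM₀ hM⟩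
    have hmv := (convex_Icc (0 : ℝ) τ).norm_image_sub_le_of_norm_hasDerivWithin_le
      (f := fun x => P.eval x) (f' := fun x => (derivative P).eval x) (C := D * (4 * n ^ 2 / τ))
      (fun x _ => (P.hasDerivAt x).hasDerivWithinAt)
      (fun x hx => abs_eval_derivative_le_of_bounded hP hτ0 hDpos hle hx) hmem
      (Set.Ioc_subset_Icc_self ht)
    rw [Real.norm_eq_abs, Real.norm_eq_abs] at hmv
    have hM₀' : (0 : ℝ) < M₀ := by exact_mod_cast hM₀
    have hn' : 8 * (n : ℝ) ^ 2 ≤ M₀ := by exact_mod_cast hn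
    have h2 : D * (4 * n ^ 2 / τ) * |t - rootInv μ M| ≤ D / 2 := by
      calc D * (4 * n ^ 2 / τ) * |t - rootInv μ M| ≤ D * (4 * n ^ 2 / τ) * (τ / M₀) := by gcongr
        _ = D / 2 * (8 * n ^ 2 / M₀) := by field_simp; ring
        _ ≤ D / 2 * 1 := by gcongr; rwa [div_le_one hM₀']
        _ = D / 2 := mul_one _
    have h3 := abs_sub_abs_le_abs_sub (P.eval t) (P.eval (rootInv μ M))
    linarith [hbd M hM]
  have hall : ∀ t ∈ Set.Icc 0 τ, |P.eval t| ≤ B + D / 2 := by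
    -- The sample points are positive, so t = 0 is reached only by continuity.
    have hcl : Set.Icc 0 τ ⊆ {t | |P.eval t| ≤ B + D / 2} := by
      rw [← closure_Ioc hτ0.ne]
      exact closure_minimal key (isClosed_le P.continuous.abs continuous_const)
    exact hcl
  linarith [hall z hz]

open Polynomial in
/-- The master inequality: if a bounded sequence `e` agrees with a polynomial `P` in `N^{-1/μ}` of
degree less than `s` up to an error `(G N^{-1/μ})^s`, then the part of degree at most `μ` of `P`
approximates `e` up to an error of order `(μ+1)/μ` in `1/N`, with polynomial control in `G`, `s`. -/
theorem abs_sub_truncation_le {μ s : ℕ} (hμ : 1 ≤ μ) (hs : μ + 1 ≤ s) {p : ℕ → ℝ} {e : ℕ → ℝ}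
    {G : ℝ} (hG : 1 ≤ G) {M₀ : ℕ} (hM₀ : 8 * s ^ 2 ≤ M₀) (hGM : G * rootInv μ M₀ ≤ 1)
    (he : ∀ N, |e N| ≤ 1)
    (happ : ∀ N, M₀ ≤ N →
      |e N - ∑ k ∈ Finset.range s, p k * rootInv μ N ^ k| ≤ (G * rootInv μ N) ^ s)
    {N : ℕ} (hN : M₀ ≤ N) (hHN : 4 * s ^ 2 * rootInv μ N ≤ rootInv μ M₀) :
    |e N - ∑ k ∈ Finset.range (μ + 1), p k * rootInv μ N ^ k| ≤
      9 * (2 * s ^ 2 / rootInv μ M₀ * rootInv μ N) ^ (μ + 1) := by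
  have hs1 : 1 ≤ s := by omega
  have hM₀pos : 0 < M₀ := lt_of_lt_of_le (by positivity) hM₀
  set τ := rootInv μ M₀ with hτ
  have hτ0 : 0 < τ := rootInv_pos μ hM₀pos
  set P : ℝ[X] := ∑ k ∈ Finset.range s, C (p k) * X ^ k with hPdef
  have hPeval : ∀ t, P.eval t = ∑ k ∈ Finset.range s, p k * t ^ k := by
    intro t; simp [hPdef, eval_finsetSum]
  have hPdeg : P.natDegree ≤ s := by
    refine natDegree_sum_le_of_forall_le _ _ fun k hk => ?_
    exact (natDegree_C_mul_X_pow_le _ _).trans (Finset.mem_range.1 hk).le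
  have hPcoeff : ∀ k, k < s → P.coeff k = p k := by
    intro k hk
    simp [hPdef, coeff_X_pow, hk]
  -- The bound 2 is 1 for |e| plus 1 for the error, since G M^{-1/μ} ≤ 1 from M₀ on.
  have hpts : ∀ M, M₀ ≤ M → |P.eval (rootInv μ M)| ≤ 2 := by
    intro M hM
    have h1 := happ M hM
    rw [← hPeval] at h1
    have h2 : (G * rootInv μ M) ^ s ≤ 1 := by
      refine pow_le_one₀ (mul_nonneg (by linarith) (rootInv_pos μ (by omega)).le) ?_
      exact (mul_le_mul_of_nonneg_left (rootInv_anti μ hM₀pos hM) (by linarith)).trans hGM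
    have h3 := abs_sub_abs_le_abs_sub (P.eval (rootInv μ M)) (e M)
    rw [abs_sub_comm] at h1
    linarith [he M]
  have hbd := abs_eval_le_of_bounded_rootInv hPdeg hμ hM₀pos hM₀ two_pos hpts
  set H := 2 * (s : ℝ) ^ 2 / τ with hH
  have hcoeff : ∀ k, k < s → |p k| ≤ 4 * H ^ k := by
    intro k hk
    rw [← hPcoeff k hk]
    have := abs_coeff_le_of_bounded hPdeg hτ0 (B := 2 * 2) (by norm_num) hbd k
    linarith
  set t := rootInv μ N with ht
  have ht0 : 0 < t := rootInv_pos μ (by omega)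
  have hH0 : 0 < H := by positivity
  have hHt : H * t ≤ 1 / 2 := by
    rw [hH, div_mul_eq_mul_div, div_le_iff₀ hτ0]; linarith
  -- Because Gτ ≤ 1 ≤ 2s², the error (Gt)^s is absorbed into (Ht)^{μ+1}; this adds 1 to the 8 from
  -- the tail.
  have hHG : G ≤ H := by
    rw [hH, le_div_iff₀ hτ0]
    have : (1 : ℝ) ≤ s ^ 2 := by exact_mod_cast Nat.one_le_pow _ _ hs1
    linarith
  have hHt0 : 0 ≤ H * t := by positivity
  have hsplit := Finset.sum_range_add_sum_Ico (fun k => p k * t ^ k) hs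
  have htail : |∑ k ∈ Finset.Ico (μ + 1) s, p k * t ^ k| ≤ 8 * (H * t) ^ (μ + 1) := by
    calc |∑ k ∈ Finset.Ico (μ + 1) s, p k * t ^ k|
        ≤ ∑ k ∈ Finset.Ico (μ + 1) s, |p k * t ^ k| := Finset.abs_sum_le_sum_abs _ _
      _ ≤ ∑ k ∈ Finset.Ico (μ + 1) s, 4 * (H * t) ^ k := by
          refine Finset.sum_le_sum fun k hk => ?_
          rw [abs_mul, abs_of_pos (pow_pos ht0 k), mul_pow, ← mul_assoc]
          exact mul_le_mul_of_nonneg_right (hcoeff k (Finset.mem_Ico.1 hk).2) (by positivity)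
      _ = 4 * ∑ k ∈ Finset.Ico (μ + 1) s, (H * t) ^ k := by rw [Finset.mul_sum]
      _ ≤ 4 * ((H * t) ^ (μ + 1) / (1 - H * t)) := by
          gcongr
          exact geom_sum_Ico_le_of_lt_one hHt0 (by linarith)
      _ ≤ 4 * ((H * t) ^ (μ + 1) / (1 / 2)) := by
          gcongr; linarith
      _ = 8 * (H * t) ^ (μ + 1) := by ring
  have herr : (G * t) ^ s ≤ (H * t) ^ (μ + 1) := by
    have hGt : G * t ≤ H * t := by gcongr
    calc (G * t) ^ s ≤ (H * t) ^ s := by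
          exact pow_le_pow_left₀ (mul_nonneg (by linarith) ht0.le) hGt s
      _ ≤ (H * t) ^ (μ + 1) := pow_le_pow_of_le_one hHt0 (by linarith) hs
  have h1 := happ N hN
  rw [← hsplit] at h1
  have h2 : e N - ∑ k ∈ Finset.range (μ + 1), p k * t ^ k =
      (e N - (∑ k ∈ Finset.range (μ + 1), p k * t ^ k + ∑ k ∈ Finset.Ico (μ + 1) s, p k * t ^ k)) +
        ∑ k ∈ Finset.Ico (μ + 1) s, p k * t ^ k := by ring
  rw [h2]
  refine (abs_add_le _ _).trans ?_
  linarith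

/-! ### A submultiplicative coefficient norm and the cutoff polynomial -/

section CoeffNorm
open Polynomial

/-- The sum `∑ |f_j| r^j` over the coefficients of a polynomial. -/
def coeffNorm (r : ℝ) (f : ℝ[X]) : ℝ := f.sum fun j c => |c| * r ^ j

theorem coeffNorm_eq_sum_range (r : ℝ) {f : ℝ[X]} {n : ℕ} (hn : f.natDegree < n) :
    coeffNorm r f = ∑ j ∈ Finset.range n, |f.coeff j| * r ^ j :=
  f.sum_over_range' (by simp) n hn

theorem coeffNorm_nonneg {r : ℝ} (hr : 0 ≤ r) (f : ℝ[X]) : 0 ≤ coeffNorm r f :=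
  Finset.sum_nonneg fun _ _ => by positivity

theorem coeffNorm_add_le {r : ℝ} (hr : 0 ≤ r) (f g : ℝ[X]) :
    coeffNorm r (f + g) ≤ coeffNorm r f + coeffNorm r g := by
  set n := max f.natDegree g.natDegree + 1 with hn
  have hf : f.natDegree < n := by omega
  have hg : g.natDegree < n := by omega
  have hfg : (f + g).natDegree < n := lt_of_le_of_lt (natDegree_add_le f g) (by omega)
  rw [coeffNorm_eq_sum_range r hf, coeffNorm_eq_sum_range r hg, coeffNorm_eq_sum_range r hfg,
    ← Finset.sum_add_distrib]
  refine Finset.sum_le_sum fun j _ => ?_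
  rw [coeff_add, ← add_mul]
  exact mul_le_mul_of_nonneg_right (abs_add_le _ _) (by positivity)

theorem coeffNorm_neg (r : ℝ) (f : ℝ[X]) : coeffNorm r (-f) = coeffNorm r f := by
  simp [coeffNorm, Polynomial.sum]

theorem coeffNorm_monomial (r : ℝ) (j : ℕ) (c : ℝ) :
    coeffNorm r (monomial j c) = |c| * r ^ j :=
  sum_monomial_index c _ (by simp)

theorem coeffNorm_monomial_mul (r : ℝ) (j : ℕ) (c : ℝ) (f : ℝ[X]) :
    coeffNorm r (monomial j c * f) = |c| * r ^ j * coeffNorm r f := by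
  have hdeg : (monomial j c * f).natDegree < j + (f.natDegree + 1) := by
    refine lt_of_le_of_lt natDegree_mul_le ?_
    have := natDegree_monomial_le c (m := j)
    omega
  rw [coeffNorm_eq_sum_range r hdeg, coeffNorm_eq_sum_range r (Nat.lt_succ_self f.natDegree),
    Finset.sum_range_add, Finset.mul_sum, Finset.sum_eq_zero, zero_add]
  · refine Finset.sum_congr rfl fun i _ => ?_
    rw [add_comm j i, ← C_mul_X_pow_eq_monomial, mul_assoc, coeff_C_mul, coeff_X_pow_mul, abs_mul]
    ring
  · intro i hi
    rw [← C_mul_X_pow_eq_monomial, mul_assoc, coeff_C_mul, coeff_X_pow_mul',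
      if_neg (by simpa using hi)]
    simp

theorem coeffNorm_mul_le {r : ℝ} (hr : 0 ≤ r) (f g : ℝ[X]) :
    coeffNorm r (f * g) ≤ coeffNorm r f * coeffNorm r g := by
  have hsum : ∀ (s : Finset ℕ) (F : ℕ → ℝ[X]),
      coeffNorm r (∑ i ∈ s, F i) ≤ ∑ i ∈ s, coeffNorm r (F i) := fun s F =>
    Finset.le_sum_of_subadditive _ (by simp [coeffNorm]) (coeffNorm_add_le hr) s F
  conv_lhs => rw [f.as_sum_support, Finset.sum_mul]
  refine (hsum _ _).trans (le_of_eq ?_)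
  simp_rw [coeffNorm_monomial_mul]
  rw [← Finset.sum_mul]
  rfl

theorem coeffNorm_one (r : ℝ) : coeffNorm r 1 = 1 := by
  rw [← monomial_zero_one, coeffNorm_monomial]; simp

theorem coeffNorm_pow_le {r : ℝ} (hr : 0 ≤ r) (f : ℝ[X]) (n : ℕ) :
    coeffNorm r (f ^ n) ≤ coeffNorm r f ^ n := by
  induction n with
  | zero => simp [coeffNorm_one]
  | succ n ih =>
    rw [pow_succ, pow_succ]
    exact (coeffNorm_mul_le hr _ _).trans
      (mul_le_mul_of_nonneg_right ih (coeffNorm_nonneg hr f))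

/-- Expanding in powers of z, the binomial coefficients in absolute value are those of (1 + z)^n -
1. -/
theorem coeffNorm_one_sub_pow_le {r : ℝ} (hr : 0 ≤ r) (z : ℝ[X]) (n : ℕ) :
    coeffNorm r (1 - (1 - z) ^ n) ≤ (1 + coeffNorm r z) ^ n - 1 := by
  induction n with
  | zero => simp [coeffNorm]
  | succ n ih =>
    set g := 1 - (1 - z) ^ n with hg
    have h1 : 1 - (1 - z) ^ (n + 1) = g + (z + -(z * g)) := by rw [hg]; ring
    rw [h1]
    have h2 := coeffNorm_add_le hr g (z + -(z * g))
    have h3 := coeffNorm_add_le hr z (-(z * g))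
    rw [coeffNorm_neg] at h3
    have h4 := coeffNorm_mul_le hr z g
    have h5 := mul_le_mul_of_nonneg_left ih (coeffNorm_nonneg hr z)
    rw [pow_succ]
    linarith

/-- A polynomial which is small in the disc of radius `r`, takes values in `[0, 1]` on `[-K, K]`,
and is at least `1/2` on the part of `[-K, K]` at distance at least `a > r` from `0`. -/
theorem exists_cutoff_polynomial {r a K θ : ℝ} (hr : 0 < r) (hra : r < a) (haK : a ≤ K)
    (hθ : 0 < θ) (hθ1 : θ ≤ 1) :
    ∃ f : ℝ[X], (∀ t, |t| ≤ K → 0 ≤ f.eval t ∧ f.eval t ≤ 1) ∧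
      (∀ t, a ≤ |t| → |t| ≤ K → 1 / 2 ≤ f.eval t) ∧ coeffNorm r f ≤ θ := by
  have ha : 0 < a := hr.trans hra
  have hq : r / a < 1 := (div_lt_one ha).2 hra
  -- The cutoff is 1 - (1 - z)^n with z = (t/a)^{2m}/n. The exponent m makes w = (r/a)^{2m} < θ/2,
  -- whence the norm is at most e^w - 1 ≤ 2w ≤ θ. The integer n ≥ (K/a)^{2m} keeps z in [0,1] on
  -- [-K, K]. For |t| ≥ a one has z ≥ 1/n, so (1 - z)^n ≤ e^{-1} ≤ 1/2.
  obtain ⟨m, hm⟩ := exists_pow_lt_of_lt_one (half_pos hθ) (show (r / a) ^ 2 < 1 by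
    exact pow_lt_one₀ (by positivity) hq two_ne_zero)
  rw [← pow_mul] at hm
  obtain ⟨n, hn⟩ := exists_nat_ge ((K / a) ^ (2 * m))
  have hKa : 1 ≤ K / a := (one_le_div ha).2 haK
  have hn1 : (1 : ℝ) ≤ n := (one_le_pow₀ hKa).trans hn
  have hn0 : (0 : ℝ) < n := by linarith
  set z : ℝ[X] := monomial (2 * m) ((n * a ^ (2 * m))⁻¹) with hz
  have hzev : ∀ t, z.eval t = (|t| / a) ^ (2 * m) / n := by
    intro t
    rw [hz, eval_monomial, div_pow, pow_mul |t|, sq_abs, ← pow_mul]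
    field_simp
  have hz1 : ∀ t, |t| ≤ K → 0 ≤ z.eval t ∧ z.eval t ≤ 1 := by
    intro t ht
    rw [hzev]
    refine ⟨by positivity, ?_⟩
    rw [div_le_one hn0]
    refine le_trans ?_ hn
    gcongr
  refine ⟨1 - (1 - z) ^ n, ?_, ?_, ?_⟩
  · intro t ht
    obtain ⟨h0, h1⟩ := hz1 t ht
    simp only [eval_sub, eval_one, eval_pow]
    have h2 : 0 ≤ (1 - z.eval t) ^ n := pow_nonneg (by linarith) n
    have h3 : (1 - z.eval t) ^ n ≤ 1 := pow_le_one₀ (by linarith) (by linarith)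
    constructor <;> linarith
  · intro t hat ht
    obtain ⟨h0, h1⟩ := hz1 t ht
    simp only [eval_sub, eval_one, eval_pow]
    have h2 : 1 / (n : ℝ) ≤ z.eval t := by
      rw [hzev]
      have : 1 ≤ (|t| / a) ^ (2 * m) := one_le_pow₀ ((one_le_div ha).2 hat)
      gcongr
    have h3 : (1 - z.eval t) ^ n ≤ Real.exp (-1) := by
      calc (1 - z.eval t) ^ n ≤ (Real.exp (-(1 / n))) ^ n := by
            refine pow_le_pow_left₀ (by linarith) ?_ n
            have := Real.add_one_le_exp (-(1 / (n : ℝ)))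
            linarith
        _ = Real.exp (-1) := by
            rw [← Real.exp_nat_mul]; congr 1; field_simp
    have h4 : Real.exp (-1) ≤ 1 / 2 := by
      rw [Real.exp_neg, ← one_div]
      exact one_div_le_one_div_of_le two_pos (by linarith [Real.add_one_le_exp (1 : ℝ)])
    linarith
  · refine (coeffNorm_one_sub_pow_le hr.le z n).trans ?_
    have hzn : coeffNorm r z = (r / a) ^ (2 * m) / n := by
      rw [hz, coeffNorm_monomial, abs_of_pos (by positivity), div_pow]
      field_simp
    set w := (r / a) ^ (2 * m) with hw
    have hw0 : 0 ≤ w := by positivity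
    rw [hzn]
    have h1 : (1 + w / n) ^ n ≤ Real.exp w := by
      calc (1 + w / n) ^ n ≤ (Real.exp (w / n)) ^ n := by
            refine pow_le_pow_left₀ (by positivity) ?_ n
            have := Real.add_one_le_exp (w / n)
            linarith
        _ = Real.exp w := by
            rw [← Real.exp_nat_mul]; congr 1; field_simp
    have h2 := Real.abs_exp_sub_one_le (x := w) (by rw [abs_of_nonneg hw0]; linarith)
    rw [abs_of_nonneg hw0] at h2
    linarith [le_abs_self (Real.exp w - 1)]

end CoeffNorm

/-! ### The ℓ¹ norm and word length on the group algebra -/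

section GroupAlgebra
variable {Γ : Type*}

/-- The `ℓ¹` norm on the group algebra. -/
def ellOne (y : MonoidAlgebra ℂ Γ) : ℝ := y.coeff.sum fun _ c => ‖c‖

theorem ellOne_nonneg (y : MonoidAlgebra ℂ Γ) : 0 ≤ ellOne y :=
  Finset.sum_nonneg fun _ _ => norm_nonneg _

theorem ellOne_eq_sum {y : MonoidAlgebra ℂ Γ} {s : Finset Γ} (hs : y.coeff.support ⊆ s) :
    ellOne y = ∑ γ ∈ s, ‖y.coeff γ‖ :=
  Finsupp.sum_of_support_subset _ hs _ (by simp)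

theorem ellOne_add_le (y z : MonoidAlgebra ℂ Γ) : ellOne (y + z) ≤ ellOne y + ellOne z := by
  classical
  rw [ellOne_eq_sum (y := y + z) (s := y.coeff.support ∪ z.coeff.support) Finsupp.support_add,
    ellOne_eq_sum (Finset.subset_union_left (s₂ := z.coeff.support)),
    ellOne_eq_sum (Finset.subset_union_right (s₁ := y.coeff.support)), ← Finset.sum_add_distrib]
  exact Finset.sum_le_sum fun γ _ => norm_add_le _ _

theorem ellOne_single (γ : Γ) (c : ℂ) : ellOne (MonoidAlgebra.single γ c) = ‖c‖ :=
  Finsupp.sum_single_index (by simp)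

variable [Group Γ]

theorem ellOne_mul_le (y z : MonoidAlgebra ℂ Γ) : ellOne (y * z) ≤ ellOne y * ellOne z := by
  have hsum : ∀ (s : Finset Γ) (F : Γ → MonoidAlgebra ℂ Γ),
      ellOne (∑ i ∈ s, F i) ≤ ∑ i ∈ s, ellOne (F i) := fun s F =>
    Finset.le_sum_of_subadditive _ (by simp [ellOne]) ellOne_add_le s F
  rw [MonoidAlgebra.mul_def]
  refine (hsum _ _).trans ?_
  rw [ellOne, Finsupp.sum, Finset.sum_mul]
  refine Finset.sum_le_sum fun γ _ => (hsum _ _).trans (le_of_eq ?_)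
  simp only [ellOne_single, norm_mul]
  rw [← Finset.mul_sum]
  rfl

theorem ellOne_pow_le (y : MonoidAlgebra ℂ Γ) (n : ℕ) : ellOne (y ^ n) ≤ ellOne y ^ n := by
  induction n with
  | zero => simp [MonoidAlgebra.one_def, ellOne_single]
  | succ n ih =>
    rw [pow_succ, pow_succ]
    exact (ellOne_mul_le _ _).trans (mul_le_mul_of_nonneg_right ih (ellOne_nonneg y))

theorem norm_map_le_ellOne {E : Type*} [SeminormedAddCommGroup E] [NormedSpace ℂ E]
    (T : MonoidAlgebra ℂ Γ →ₗ[ℂ] E) (y : MonoidAlgebra ℂ Γ) {B : ℝ}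
    (hB : ∀ γ ∈ y.coeff.support, ‖T (MonoidAlgebra.single γ 1)‖ ≤ B) :
    ‖T y‖ ≤ ellOne y * B := by
  have h : T y = ∑ γ ∈ y.coeff.support, y.coeff γ • T (MonoidAlgebra.single γ 1) := by
    conv_lhs => rw [← MonoidAlgebra.sum_coeff_single y, Finsupp.sum, map_sum]
    refine Finset.sum_congr rfl fun γ _ => ?_
    rw [← map_smul, MonoidAlgebra.smul_single, smul_eq_mul, mul_one]
  rw [h, ellOne, Finsupp.sum, Finset.sum_mul]
  refine norm_sum_le_of_le _ fun γ hγ => ?_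
  rw [norm_smul]
  exact mul_le_mul_of_nonneg_left (hB γ hγ) (norm_nonneg _)

-- This replaces a functional calculus for v: growth of the moments at rate r is all that is needed
-- to bound v on every polynomial in x.
open Polynomial in
theorem norm_map_aeval_le {v : MonoidAlgebra ℂ Γ →ₗ[ℂ] ℂ} {x : MonoidAlgebra ℂ Γ} {c r : ℝ}
    (hv : ∀ p, ‖v (x ^ p)‖ ≤ c * r ^ p) (f : ℝ[X]) :
    ‖v (aeval x (f.map (algebraMap ℝ ℂ)))‖ ≤ c * coeffNorm r f := by
  rw [aeval_eq_sum_range, map_sum, natDegree_map,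
    coeffNorm_eq_sum_range r (Nat.lt_succ_self f.natDegree), Finset.mul_sum]
  refine norm_sum_le_of_le _ fun j _ => ?_
  rw [map_smul, norm_smul, coeff_map, Complex.coe_algebraMap, Complex.norm_real, Real.norm_eq_abs]
  nlinarith [hv j, abs_nonneg (f.coeff j)]

theorem exists_word {S : Finset Γ} (hS : IsSymmGenSet S) (γ : Γ) :
    ∃ l : List Γ, l.length = wordLength S γ ∧ (∀ s ∈ l, s ∈ S) ∧ l.prod = γ := by
  have hne : {n | ∃ l : List Γ, l.length = n ∧ (∀ s ∈ l, s ∈ S) ∧ l.prod = γ}.Nonempty := by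
    have hγ : γ ∈ Subgroup.closure (S : Set Γ) := by rw [hS.2]; trivial
    rw [← Subgroup.mem_toSubmonoid, Subgroup.closure_toSubmonoid] at hγ
    obtain ⟨l, hl, hprod⟩ := Submonoid.exists_list_of_mem_closure hγ
    refine ⟨l.length, l, rfl, fun s hs => ?_, hprod⟩
    rcases hl s hs with h | h
    · exact h
    · simpa using hS.1 _ h
  exact Nat.sInf_mem hne

theorem wordLength_mul_le {S : Finset Γ} (hS : IsSymmGenSet S) (γ δ : Γ) :
    wordLength S (γ * δ) ≤ wordLength S γ + wordLength S δ := by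
  obtain ⟨l, hl, hlS, rfl⟩ := exists_word hS γ
  obtain ⟨l', hl', hlS', rfl⟩ := exists_word hS δ
  rw [← hl, ← hl']
  refine Nat.sInf_le ⟨l ++ l', by simp, fun s hs => ?_, by simp⟩
  rcases List.mem_append.1 hs with h | h
  exacts [hlS s h, hlS' s h]

theorem wordLength_one (S : Finset Γ) : wordLength S (1 : Γ) = 0 :=
  Nat.le_zero.1 (Nat.sInf_le ⟨[], by simp⟩)

theorem wordLength_le_of_mem_support_pow {S : Finset Γ} (hS : IsSymmGenSet S)
    {y : MonoidAlgebra ℂ Γ} {n : ℕ} (hy : ∀ γ ∈ y.coeff.support, wordLength S γ ≤ n) (L : ℕ) :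
    ∀ γ ∈ (y ^ L).coeff.support, wordLength S γ ≤ n * L := by
  classical
  induction L with
  | zero =>
    intro γ hγ
    have := MonoidAlgebra.support_coeff_one_subset (k := ℂ) (by simpa using hγ)
    rw [Finset.mem_one.1 this, wordLength_one]
    exact Nat.zero_le _
  | succ L ih =>
    intro γ hγ
    rw [pow_succ] at hγ
    obtain ⟨g, hg, h, hh, rfl⟩ := Finset.mem_mul.1 (MonoidAlgebra.support_coeff_mul_subset _ _ hγ)
    calc wordLength S (g * h) ≤ wordLength S g + wordLength S h := wordLength_mul_le hS g h
      _ ≤ n * L + n := add_le_add (ih g hg) (hy h hh)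
      _ = n * (L + 1) := by ring

end GroupAlgebra

/-! ### The involution and the C*-identity -/

section Involution
variable {Γ : Type*} [Group Γ]

/-- The involution `(∑ a_γ γ)^* = ∑ conj(a_γ) γ⁻¹` of the group algebra. -/
def involution (x : MonoidAlgebra ℂ Γ) : MonoidAlgebra ℂ Γ :=
  .ofCoeff ((x.coeff.equivMapDomain (Equiv.inv Γ)).mapRange star (star_zero ℂ))

theorem coeff_involution (x : MonoidAlgebra ℂ Γ) (γ : Γ) :
    (involution x).coeff γ = star (x.coeff γ⁻¹) := by
  simp [involution]

theorem involution_add (x y : MonoidAlgebra ℂ Γ) :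
    involution (x + y) = involution x + involution y := by
  ext γ
  simp [coeff_involution]

theorem involution_single (γ : Γ) (c : ℂ) :
    involution (MonoidAlgebra.single γ c) = MonoidAlgebra.single γ⁻¹ (star c) := by
  classical
  ext δ
  simp only [coeff_involution, MonoidAlgebra.coeff_single, Finsupp.single_apply,
    inv_eq_iff_eq_inv]
  split_ifs <;> simp

theorem involution_zero : involution (0 : MonoidAlgebra ℂ Γ) = 0 := by
  ext γ
  simp [coeff_involution]

theorem involution_involution (x : MonoidAlgebra ℂ Γ) : involution (involution x) = x := by
  ext γ
  simp [coeff_involution]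

theorem involution_mul (x y : MonoidAlgebra ℂ Γ) :
    involution (x * y) = involution y * involution x := by
  induction x using MonoidAlgebra.induction_linear with
  | zero => simp [involution_zero]
  | add x₁ x₂ h₁ h₂ => simp [add_mul, mul_add, involution_add, h₁, h₂]
  | single γ c =>
    induction y using MonoidAlgebra.induction_linear with
    | zero => simp [involution_zero]
    | add y₁ y₂ h₁ h₂ => simp [add_mul, mul_add, involution_add, h₁, h₂]
    | single δ d =>
      simp [involution_single, MonoidAlgebra.single_mul_single, mul_comm]

theorem IsSelfAdj.involution_eq {x : MonoidAlgebra ℂ Γ} (hx : IsSelfAdj x) : involution x = x := by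
  ext γ
  rw [coeff_involution, hx γ, star_star]

theorem isSelfAdj_involution_mul_self (x : MonoidAlgebra ℂ Γ) : IsSelfAdj (involution x * x) := by
  intro γ
  have h : involution (involution x * x) = involution x * x := by
    rw [involution_mul, involution_involution]
  conv_lhs => rw [← h]
  rw [coeff_involution, inv_inv]

variable {E : Type*} [NormedAddCommGroup E] [InnerProductSpace ℂ E] [CompleteSpace E]

theorem star_apply_of_isometric {ρ : Γ →* (E →L[ℂ] E)} (hρ : ∀ γ v, ‖ρ γ v‖ = ‖v‖) (γ : Γ) :
    star (ρ γ) = ρ γ⁻¹ := by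
  rw [ContinuousLinearMap.star_eq_adjoint]
  symm
  rw [ContinuousLinearMap.eq_adjoint_iff]
  intro v w
  have h := (⟨(ρ γ : E →ₗ[ℂ] E), hρ γ⟩ : E →ₗᵢ[ℂ] E).inner_map_map (ρ γ⁻¹ v) w
  have h2 : ρ γ (ρ γ⁻¹ v) = v := by
    rw [← mul_apply_eq_comp, ← map_mul, mul_inv_cancel, map_one]
    rfl
  rw [← h]
  exact congrArg (fun z => inner ℂ z (ρ γ w)) h2

theorem lift_involution {ρ : Γ →* (E →L[ℂ] E)} (hρ : ∀ γ v, ‖ρ γ v‖ = ‖v‖)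
    (x : MonoidAlgebra ℂ Γ) :
    MonoidAlgebra.lift ℂ (E →L[ℂ] E) Γ ρ (involution x) =
      star (MonoidAlgebra.lift ℂ (E →L[ℂ] E) Γ ρ x) := by
  induction x using MonoidAlgebra.induction_linear with
  | zero => simp [involution_zero]
  | add x₁ x₂ h₁ h₂ => rw [involution_add, map_add, map_add, star_add, h₁, h₂]
  | single γ c =>
    rw [involution_single, MonoidAlgebra.lift_single, MonoidAlgebra.lift_single, star_smul,
      star_apply_of_isometric hρ]

theorem norm_lift_involution_mul_self {ρ : Γ →* (E →L[ℂ] E)} (hρ : ∀ γ v, ‖ρ γ v‖ = ‖v‖)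
    (x : MonoidAlgebra ℂ Γ) :
    ‖MonoidAlgebra.lift ℂ (E →L[ℂ] E) Γ ρ (involution x * x)‖ =
      ‖MonoidAlgebra.lift ℂ (E →L[ℂ] E) Γ ρ x‖ ^ 2 := by
  rw [map_mul, lift_involution hρ, CStarRing.norm_star_mul_self, sq]

theorem norm_lift_le_ellOne {ρ : Γ →* (E →L[ℂ] E)} (hρ : ∀ γ v, ‖ρ γ v‖ = ‖v‖)
    (x : MonoidAlgebra ℂ Γ) :
    ‖MonoidAlgebra.lift ℂ (E →L[ℂ] E) Γ ρ x‖ ≤ ellOne x := by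
  have h := norm_map_le_ellOne (MonoidAlgebra.lift ℂ (E →L[ℂ] E) Γ ρ).toLinearMap x (B := 1) ?_
  · simpa using h
  · intro γ _
    simp only [AlgHom.toLinearMap_apply, MonoidAlgebra.lift_single, one_smul]
    exact ContinuousLinearMap.opNorm_le_bound _ zero_le_one fun v => by rw [hρ, one_mul]

theorem norm_leftRegular_apply (γ : Γ) (v : EllTwo Γ) : ‖leftRegular Γ γ v‖ = ‖v‖ :=
  (leftTranslate γ).norm_map v

theorem norm_stdRep_apply {N : ℕ} (φ : Γ →* Equiv.Perm (Fin N)) (γ : Γ) (v : StdSpace N) :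
    ‖stdRep φ γ v‖ = ‖v‖ :=
  (LinearIsometryEquiv.piLpCongrLeft 2 ℂ ℂ (φ γ)).norm_map v

end Involution

/-! ### Traces and eigenvalues of self-adjoint operators -/

section SelfAdjoint
open Polynomial
variable {E : Type*} [NormedAddCommGroup E] [InnerProductSpace ℂ E]

theorem aeval_apply_of_apply_eq_smul {X : E →L[ℂ] E} {v : E} {c : ℂ} (h : X v = c • v)
    (F : ℂ[X]) : aeval X F v = F.eval c • v := by
  induction F using Polynomial.induction_on' with
  | add p q hp hq => simp [add_smul, hp, hq]
  | monomial n a =>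
    have hpow : ∀ n : ℕ, (X ^ n) v = c ^ n • v := by
      intro n
      induction n with
      | zero => simp
      | succ n ih => rw [pow_succ, mul_apply_eq_comp, h, map_smul, ih, smul_smul,
          pow_succ, mul_comm]
    simp [aeval_monomial, Algebra.algebraMap_eq_smul_one, hpow, smul_smul]

variable [FiniteDimensional ℂ E]

theorem trace_aeval_eq_sum {X : E →L[ℂ] E} (hX : (X : E →ₗ[ℂ] E).IsSymmetric) (f : ℝ[X]) :
    LinearMap.trace ℂ E (aeval X (f.map (algebraMap ℝ ℂ)) : E →L[ℂ] E) =
      ((∑ i, f.eval (hX.eigenvalues rfl i) : ℝ) : ℂ) := by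
  rw [LinearMap.trace_eq_sum_inner _ (hX.eigenvectorBasis rfl), Complex.ofReal_sum]
  refine Finset.sum_congr rfl fun i _ => ?_
  rw [ContinuousLinearMap.coe_coe, aeval_apply_of_apply_eq_smul (hX.apply_eigenvectorBasis rfl i),
    inner_smul_right, OrthonormalBasis.inner_eq_one, mul_one]
  rw [eval_map_algebraMap]
  exact aeval_algebraMap_apply_eq_algebraMap_eval _ f

theorem abs_eigenvalues_le {X : E →L[ℂ] E} (hX : (X : E →ₗ[ℂ] E).IsSymmetric)
    (i : Fin (Module.finrank ℂ E)) : |hX.eigenvalues rfl i| ≤ ‖X‖ := by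
  have h := hX.apply_eigenvectorBasis rfl i
  have h2 := X.le_opNorm (hX.eigenvectorBasis rfl i)
  rw [ContinuousLinearMap.coe_coe] at h
  rw [h, norm_smul, OrthonormalBasis.norm_eq_one] at h2
  simpa using h2

theorem norm_le_of_abs_eigenvalues_le {X : E →L[ℂ] E} (hX : (X : E →ₗ[ℂ] E).IsSymmetric) {c : ℝ}
    (hc : 0 ≤ c) (h : ∀ i, |hX.eigenvalues rfl i| ≤ c) : ‖X‖ ≤ c := by
  refine X.opNorm_le_bound hc fun v => ?_
  refine le_of_sq_le_sq ?_ (by positivity)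
  rw [mul_pow, ← (hX.eigenvectorBasis rfl).sum_sq_norm_inner_right (X v),
    ← (hX.eigenvectorBasis rfl).sum_sq_norm_inner_right v, Finset.mul_sum]
  refine Finset.sum_le_sum fun i _ => ?_
  have h1 := hX.eigenvectorBasis_apply_self_apply rfl v i
  rw [OrthonormalBasis.repr_apply_apply, OrthonormalBasis.repr_apply_apply,
    ContinuousLinearMap.coe_coe] at h1
  rw [h1, norm_mul, mul_pow]
  refine mul_le_mul_of_nonneg_right ?_ (by positivity)
  refine pow_le_pow_left₀ (norm_nonneg _) ?_ 2
  simpa using h i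

/-- The trace is the sum of f^L over the eigenvalues, each term in [0,1]; a norm above a forces an
eigenvalue with modulus above a, and that single term already contributes 2^{-L}. -/
theorem exists_trace_aeval_pow_eq {X : E →L[ℂ] E} (hX : (X : E →ₗ[ℂ] E).IsSymmetric) {a K : ℝ}
    (ha : 0 < a) (hK : ‖X‖ ≤ K) {f : ℝ[X]} (hf : ∀ t, |t| ≤ K → 0 ≤ f.eval t ∧ f.eval t ≤ 1)
    (hfa : ∀ t, a ≤ |t| → |t| ≤ K → 1 / 2 ≤ f.eval t) (L : ℕ) :
    ∃ T : ℝ, LinearMap.trace ℂ E (aeval X (f.map (algebraMap ℝ ℂ)) ^ L : E →L[ℂ] E) = T ∧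
      0 ≤ T ∧ T ≤ Module.finrank ℂ E ∧ (a < ‖X‖ → (1 / 2) ^ L ≤ T) := by
  have hle := fun i => (abs_eigenvalues_le hX i).trans hK
  have hnn : ∀ i, 0 ≤ (f ^ L).eval (hX.eigenvalues rfl i) := fun i => by
    rw [eval_pow]; exact pow_nonneg (hf _ (hle i)).1 L
  refine ⟨∑ i, (f ^ L).eval (hX.eigenvalues rfl i), ?_, Finset.sum_nonneg fun i _ => hnn i, ?_, ?_⟩
  · rw [← trace_aeval_eq_sum hX (f ^ L), Polynomial.map_pow, map_pow]
  · refine (Finset.sum_le_card_nsmul _ _ 1 fun i _ => ?_).trans (by simp)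
    rw [eval_pow]
    exact pow_le_one₀ (hf _ (hle i)).1 (hf _ (hle i)).2
  · intro haX
    obtain ⟨i, hi⟩ : ∃ i, a < |hX.eigenvalues rfl i| := by
      by_contra! hcon
      exact absurd (norm_le_of_abs_eigenvalues_le hX ha.le hcon) (not_le.2 haX)
    refine le_trans ?_ (Finset.single_le_sum (fun i _ => hnn i) (Finset.mem_univ i))
    rw [eval_pow]
    exact pow_le_pow_left₀ (by norm_num) (hfa _ hi.le (hle i)) L

end SelfAdjoint

/-! ### Subpolynomial growth and the choice of parameters -/

/-- A sequence growing slower than every positive power of `N`. -/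
def IsSubpolynomial (g : ℕ → ℝ) : Prop :=
  ∀ δ : ℝ, 0 < δ → g =O[atTop] fun N : ℕ => (N : ℝ) ^ δ

namespace IsSubpolynomial

theorem const (c : ℝ) : IsSubpolynomial fun _ => c := by
  intro δ hδ
  have h : Tendsto (fun N : ℕ => (N : ℝ) ^ δ) atTop atTop :=
    (tendsto_rpow_atTop hδ).comp tendsto_natCast_atTop_atTop
  refine IsLittleO.isBigO ?_
  rw [isLittleO_const_left]
  exact Or.inr (tendsto_norm_atTop_atTop.comp h)

theorem add {f g : ℕ → ℝ} (hf : IsSubpolynomial f) (hg : IsSubpolynomial g) :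
    IsSubpolynomial fun N => f N + g N := fun δ hδ => (hf δ hδ).add (hg δ hδ)

theorem mul {f g : ℕ → ℝ} (hf : IsSubpolynomial f) (hg : IsSubpolynomial g) :
    IsSubpolynomial fun N => f N * g N := by
  intro δ hδ
  refine ((hf (δ / 2) (half_pos hδ)).mul (hg (δ / 2) (half_pos hδ))).congr_right fun N => ?_
  rcases Nat.eq_zero_or_pos N with rfl | hN
  · rw [Nat.cast_zero, Real.zero_rpow hδ.ne', Real.zero_rpow (half_pos hδ).ne', mul_zero]
  · rw [← Real.rpow_add (by exact_mod_cast hN), add_halves]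

theorem rpow {f : ℕ → ℝ} (hf : IsSubpolynomial f) {p : ℝ} (hp : 0 < p) :
    IsSubpolynomial fun N => f N ^ p := by
  intro δ hδ
  refine ((hf (δ / p) (div_pos hδ hp)).rpow hp.le
    (Eventually.of_forall fun N => by positivity)).congr_right fun N => ?_
  rw [← Real.rpow_mul (Nat.cast_nonneg N), div_mul_cancel₀ _ hp.ne']

theorem pow {f : ℕ → ℝ} (hf : IsSubpolynomial f) (n : ℕ) :
    IsSubpolynomial fun N => f N ^ n := by
  induction n with
  | zero => simpa using const 1
  | succ n ih => simpa only [pow_succ] using ih.mul hf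

theorem mono {f g : ℕ → ℝ} (hg : IsSubpolynomial g) (h : ∀ N, |f N| ≤ |g N|) :
    IsSubpolynomial f := fun δ hδ =>
  (IsBigO.of_norm_le fun N => by simpa using h N : f =O[atTop] fun N => |g N|).trans
    (hg δ hδ).abs_left

theorem log : IsSubpolynomial fun N => Real.log N := fun _ hδ =>
  ((isLittleO_log_rpow_atTop hδ).comp_tendsto tendsto_natCast_atTop_atTop).isBigO

theorem tendsto_mul_rpow_neg {f : ℕ → ℝ} (hf : IsSubpolynomial f) {δ : ℝ} (hδ : 0 < δ) :
    Tendsto (fun N : ℕ => f N * (N : ℝ) ^ (-δ)) atTop (𝓝 0) := by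
  have h1 : (fun N : ℕ => f N * (N : ℝ) ^ (-δ)) =O[atTop] fun N : ℕ => (N : ℝ) ^ (-(δ / 2)) := by
    refine ((hf (δ / 2) (half_pos hδ)).mul (isBigO_refl _ _)).congr' EventuallyEq.rfl ?_
    filter_upwards [eventually_gt_atTop 0] with N hN
    rw [← Real.rpow_add (by exact_mod_cast hN)]
    congr 1; ring
  exact h1.trans_tendsto
    ((tendsto_rpow_neg_atTop (half_pos hδ)).comp tendsto_natCast_atTop_atTop)

end IsSubpolynomial

/-- The power `⌈log N / (8μ)⌉` used at `N`. -/
def cutoffPower (μ N : ℕ) : ℕ := ⌈Real.log N / (8 * μ)⌉₊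

/-- The length of the asymptotic expansion used at `N`. -/
def expansionLength (μ n N : ℕ) : ℕ := n * cutoffPower μ N + μ + 1

/-- A threshold beyond which the asymptotic expansion of length `s` is accurate. -/
def threshold (μ : ℕ) (C b : ℝ) (s : ℕ) : ℕ :=
  ⌈8 * (s : ℝ) ^ 2 + C * (s : ℝ) ^ C + (b * (C * s) ^ C) ^ μ⌉₊

theorem isSubpolynomial_cutoffPower (μ : ℕ) : IsSubpolynomial fun N => (cutoffPower μ N : ℝ) := by
  refine ((IsSubpolynomial.log.mul (.const (8 * (μ : ℝ))⁻¹)).add (.const 1)).mono fun N => ?_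
  rw [abs_of_nonneg (by positivity)]
  have h0 : 0 ≤ Real.log N / (8 * μ) := div_nonneg (Real.log_natCast_nonneg N) (by positivity)
  refine (Nat.ceil_lt_add_one h0).le.trans ?_
  rw [div_eq_mul_inv]
  exact le_abs_self _

theorem isSubpolynomial_expansionLength (μ n : ℕ) :
    IsSubpolynomial fun N => (expansionLength μ n N : ℝ) := by
  have h := ((IsSubpolynomial.const (n : ℝ)).mul (isSubpolynomial_cutoffPower μ)).add
    (.const ((μ : ℝ) + 1))
  refine h.mono fun N => le_of_eq ?_
  congr 1
  simp only [expansionLength]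
  push_cast
  ring

theorem isSubpolynomial_threshold (μ n : ℕ) {C b : ℝ} (hC : 1 ≤ C) (hb : 1 ≤ b) :
    IsSubpolynomial fun N => (threshold μ C b (expansionLength μ n N) : ℝ) := by
  have hs := isSubpolynomial_expansionLength μ n
  have hC0 : 0 < C := by linarith
  have h := ((((IsSubpolynomial.const 8).mul (hs.pow 2)).add
    ((IsSubpolynomial.const C).mul (hs.rpow hC0))).add
    (((IsSubpolynomial.const b).mul (((IsSubpolynomial.const C).mul hs).rpow hC0)).pow μ)).add
    (.const 1)
  refine h.mono fun N => ?_
  rw [abs_of_nonneg (by positivity)]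
  exact (Nat.ceil_lt_add_one (by positivity)).le.trans (le_abs_self _)

theorem two_pow_cutoffPower_le (μ : ℕ) {N : ℕ} (hN : 0 < N) :
    (2 : ℝ) ^ cutoffPower μ N ≤ 2 * (N : ℝ) ^ (1 / (8 * (μ : ℝ))) := by
  have hN' : (0 : ℝ) < N := by exact_mod_cast hN
  have h0 : 0 ≤ Real.log N / (8 * μ) := div_nonneg (Real.log_natCast_nonneg N) (by positivity)
  have hle : (cutoffPower μ N : ℝ) ≤ Real.log N / (8 * μ) + 1 := (Nat.ceil_lt_add_one h0).le
  calc (2 : ℝ) ^ cutoffPower μ N = (2 : ℝ) ^ (cutoffPower μ N : ℝ) := (Real.rpow_natCast _ _).symm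
    _ ≤ (2 : ℝ) ^ (Real.log N / (8 * μ) + 1) := Real.rpow_le_rpow_of_exponent_le one_le_two hle
    _ = 2 * (2 : ℝ) ^ (Real.log N / (8 * μ)) := by
        rw [Real.rpow_add two_pos, Real.rpow_one, mul_comm]
    _ ≤ 2 * (Real.exp 1) ^ (Real.log N / (8 * μ)) := by
        gcongr
        linarith [Real.add_one_le_exp (1 : ℝ)]
    _ = 2 * (N : ℝ) ^ (1 / (8 * (μ : ℝ))) := by
        rw [Real.exp_one_rpow, Real.rpow_def_of_pos hN', mul_one_div]

theorem exp_pow_cutoffPower_le {μ : ℕ} (hμ : 1 ≤ μ) {N : ℕ} (hN : 0 < N) :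
    (Real.exp (-(16 * μ))) ^ cutoffPower μ N ≤ (N : ℝ) ^ (-2 : ℝ) := by
  have hN' : (0 : ℝ) < N := by exact_mod_cast hN
  have hμ' : (0 : ℝ) < μ := by exact_mod_cast hμ
  have hle : Real.log N / (8 * μ) ≤ (cutoffPower μ N : ℝ) := Nat.le_ceil _
  rw [← Real.exp_nat_mul, Real.rpow_def_of_pos hN', Real.exp_le_exp]
  rw [div_le_iff₀ (by positivity)] at hle
  linarith

theorem eventually_error_le {μ : ℕ} (hμ : 1 ≤ μ) (D : ℝ) (hD : 0 ≤ D) {Q : ℕ → ℝ}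
    (hQ0 : ∀ N, 0 ≤ Q N) (hQ : IsSubpolynomial Q) :
    ∀ᶠ N : ℕ in atTop,
      2 ^ cutoffPower μ N * N * (D * (Real.exp (-(16 * μ))) ^ cutoffPower μ N +
        9 * (Q N * rootInv μ N) ^ (μ + 1)) ≤ (N : ℝ) ^ (-(1 / (2 * (μ : ℝ)))) := by
  have hμ' : (1 : ℝ) ≤ μ := by exact_mod_cast hμ
  have hμ0 : (0 : ℝ) < μ := by linarith
  -- The powers of N add up to 1/(8μ) + 1 - (1 + 1/μ) = -7/(8μ) = -3/(8μ) - 1/(2μ); the first part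
  -- of the split absorbs the subpolynomial factor.
  have hδ : (0 : ℝ) < 3 / (8 * μ) := by positivity
  have h1 := ((((IsSubpolynomial.const (2 * D)).add
    ((IsSubpolynomial.const 18).mul (hQ.pow (μ + 1)))).tendsto_mul_rpow_neg hδ)).eventually_le_const
    zero_lt_one
  filter_upwards [h1, eventually_gt_atTop 0] with N hN hN0
  have hN' : (0 : ℝ) < N := by exact_mod_cast hN0
  have hN1 : (1 : ℝ) ≤ N := by exact_mod_cast hN0
  have ht : rootInv μ N ^ (μ + 1) = (N : ℝ) ^ (-(1 + 1 / (μ : ℝ))) := by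
    rw [rootInv_pow, ← Real.rpow_neg hN'.le]
    congr 2
    push_cast
    field_simp
  have hQN : 0 ≤ Q N ^ (μ + 1) := pow_nonneg (hQ0 N) _
  have hA : (Real.exp (-(16 * μ))) ^ cutoffPower μ N ≤ (N : ℝ) ^ (-(1 + 1 / (μ : ℝ))) := by
    refine (exp_pow_cutoffPower_le hμ hN0).trans (Real.rpow_le_rpow_of_exponent_le hN1 ?_)
    have : 1 / (μ : ℝ) ≤ 1 := (div_le_one hμ0).2 hμ'
    linarith
  calc 2 ^ cutoffPower μ N * N * (D * (Real.exp (-(16 * μ))) ^ cutoffPower μ N +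
        9 * (Q N * rootInv μ N) ^ (μ + 1))
      ≤ (2 * (N : ℝ) ^ (1 / (8 * (μ : ℝ)))) * N * (D * (N : ℝ) ^ (-(1 + 1 / (μ : ℝ))) +
        9 * (Q N ^ (μ + 1) * (N : ℝ) ^ (-(1 + 1 / (μ : ℝ))))) := by
        rw [mul_pow, ht]
        gcongr
        exact two_pow_cutoffPower_le μ hN0
    _ = (2 * D + 18 * Q N ^ (μ + 1)) *
          ((N : ℝ) ^ (1 / (8 * (μ : ℝ))) * (N : ℝ) ^ (1 : ℝ) *
            (N : ℝ) ^ (-(1 + 1 / (μ : ℝ)))) := by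
        rw [Real.rpow_one]; ring
    _ = (2 * D + 18 * Q N ^ (μ + 1)) * (N : ℝ) ^ (-(3 / (8 * (μ : ℝ)))) *
          (N : ℝ) ^ (-(1 / (2 * (μ : ℝ)))) := by
        rw [← Real.rpow_add hN', ← Real.rpow_add hN', mul_assoc, ← Real.rpow_add hN']
        congr 2
        field_simp
        ring
    _ ≤ 1 * (N : ℝ) ^ (-(1 / (2 * (μ : ℝ)))) := by gcongr
    _ = _ := one_mul _

/-- Diagonal argument: at N, take ε = 1/(k+1) for the largest k ≤ N for which the bound already
holds. -/
theorem exists_tendsto_zero_of_forall_eventually {P : ℝ → ℕ → ℝ} {g : ℕ → ℝ}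
    (h : ∀ ε, 0 < ε → ∀ᶠ N in atTop, P ε N ≤ g N) :
    ∃ ε : ℕ → ℝ, Tendsto ε atTop (𝓝 0) ∧ ∀ᶠ N in atTop, P (ε N) N ≤ g N := by
  classical
  set k : ℕ → ℕ := fun N => Nat.findGreatest (fun k => P (1 / ((k : ℝ) + 1)) N ≤ g N) N with hk
  have hk_tendsto : Tendsto k atTop atTop := by
    refine tendsto_atTop.2 fun b => ?_
    filter_upwards [h (1 / ((b : ℝ) + 1)) (by positivity), eventually_ge_atTop b] with N hN hbN
    exact Nat.le_findGreatest hbN hN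
  refine ⟨fun N => 1 / ((k N : ℝ) + 1),
    tendsto_one_div_add_atTop_nhds_zero_nat.comp hk_tendsto, ?_⟩
  -- `Nat.findGreatest` defaults to 0, so its property is guaranteed only once k = 0 satisfies the
  -- bound.
  filter_upwards [h (1 / (((0 : ℕ) : ℝ) + 1)) (by positivity)] with N hN
  exact Nat.findGreatest_spec (P := fun k => P (1 / ((k : ℝ) + 1)) N ≤ g N) (Nat.zero_le N) hN

/-! ### Moment bounds and the expected trace -/

section Representations

open Polynomial (aeval)

variable {Γ : Type*} [Group Γ]

section Tempered

/-- The limsup gives the bound with constant 1 for large p; the finitely many remaining ratios are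
added to the constant. -/
theorem IsTemperedAt.exists_norm_pow_le {v : MonoidAlgebra ℂ Γ →ₗ[ℂ] ℂ} {x : MonoidAlgebra ℂ Γ}
    (h : IsTemperedAt v x) {r : ℝ} (hr : ‖leftRegularAlg Γ x‖ < r) :
    ∃ c : ℝ, 0 ≤ c ∧ ∀ p, ‖v (x ^ p)‖ ≤ c * r ^ p := by
  have hr0 : 0 < r := (norm_nonneg _).trans_lt hr
  have hlt : limsup (fun p : ℕ => ‖v (x ^ p)‖ₑ ^ (1 / (p : ℝ))) atTop < ENNReal.ofReal r := by
    refine lt_of_le_of_lt h ?_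
    rw [← ofReal_norm]
    exact (ENNReal.ofReal_lt_ofReal_iff hr0).2 hr
  obtain ⟨p₀, hp₀⟩ := eventually_atTop.1 (eventually_lt_of_limsup_lt hlt)
  have hnn : ∀ i ∈ Finset.range (p₀ + 1), 0 ≤ ‖v (x ^ i)‖ / r ^ i := fun i _ => by positivity
  refine ⟨1 + ∑ i ∈ Finset.range (p₀ + 1), ‖v (x ^ i)‖ / r ^ i,
    add_nonneg zero_le_one (Finset.sum_nonneg hnn), fun p => ?_⟩
  rw [← div_le_iff₀ (pow_pos hr0 p)]
  rcases le_or_gt p p₀ with hp | hp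
  · have := Finset.single_le_sum hnn (Finset.mem_range.2 (Nat.lt_succ_of_le hp))
    linarith
  · have h1 := (hp₀ p hp.le).le
    have hp0 : (p : ℝ) ≠ 0 := by exact_mod_cast (by omega : p ≠ 0)
    have h2 := ENNReal.rpow_le_rpow h1 (Nat.cast_nonneg p)
    rw [← ENNReal.rpow_mul, one_div_mul_cancel hp0, ENNReal.rpow_one, ENNReal.rpow_natCast,
      ← ENNReal.ofReal_pow hr0.le, ← ofReal_norm,
      ENNReal.ofReal_le_ofReal_iff (by positivity)] at h2
    have h3 : ‖v (x ^ p)‖ / r ^ p ≤ 1 := (div_le_one (by positivity)).2 h2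
    linarith [Finset.sum_nonneg hnn]

theorem linExt_single (u : Γ → ℝ) (γ : Γ) (c : ℂ) :
    linExt u (MonoidAlgebra.single γ c) = c * u γ := by
  simp [linExt]

theorem linExt_eq_canonicalTrace {u : Γ → ℝ}
    (hu : ∀ γ, (u γ : ℂ) = canonicalTrace (leftRegular Γ γ)) (y : MonoidAlgebra ℂ Γ) :
    linExt u y = canonicalTrace (leftRegularAlg Γ y) := by
  induction y using MonoidAlgebra.induction_linear with
  | zero => simp [canonicalTrace]
  | add y z hy hz => simp only [map_add, hy, hz, canonicalTrace, add_apply,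
      inner_add_right]
  | single γ c =>
    rw [linExt_single, hu, leftRegularAlg, MonoidAlgebra.lift_single]
    simp only [canonicalTrace, smul_apply, inner_smul_right]

theorem norm_canonicalTrace_le (a : EllTwo Γ →L[ℂ] EllTwo Γ) : ‖canonicalTrace a‖ ≤ ‖a‖ := by
  have key : ∀ δ : EllTwo Γ, ‖δ‖ = 1 → ‖inner ℂ δ (a δ)‖ ≤ ‖a‖ := fun δ hδ => by
    have h1 := norm_inner_le_norm (𝕜 := ℂ) δ (a δ)
    have h2 := a.le_opNorm δ
    rw [hδ, one_mul] at h1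
    rw [hδ, mul_one] at h2
    exact h1.trans h2
  classical exact key _ (by rw [lp.norm_single (by norm_num)]; simp)

/-- Temperedness is assumed only for k ≥ 1; for k = 0 it is automatic, the canonical trace being a
vector state. -/
theorem norm_linExt_pow_le {u : Γ → ℝ} (hu : ∀ γ, (u γ : ℂ) = canonicalTrace (leftRegular Γ γ))
    {x : MonoidAlgebra ℂ Γ} {r : ℝ} (hr : ‖leftRegularAlg Γ x‖ ≤ r) (p : ℕ) :
    ‖linExt u (x ^ p)‖ ≤ 1 * r ^ p := by
  rw [linExt_eq_canonicalTrace hu, one_mul, map_pow]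
  refine (norm_canonicalTrace_le _).trans ?_
  rcases Nat.eq_zero_or_pos p with rfl | hp
  · rw [pow_zero, pow_zero]
    exact ContinuousLinearMap.norm_id_le
  · exact (norm_pow_le' _ hp).trans (pow_le_pow_left₀ (norm_nonneg _) hr p)

end Tempered

section Expectation

theorem isSymmetric_stdRepAlg {N : ℕ} (φ : Γ →* Equiv.Perm (Fin N)) {x : MonoidAlgebra ℂ Γ}
    (hx : IsSelfAdj x) : ((stdRepAlg φ x : StdSpace N →L[ℂ] StdSpace N) :
      StdSpace N →ₗ[ℂ] StdSpace N).IsSymmetric := by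
  have h := lift_involution (norm_stdRep_apply φ) x
  rw [hx.involution_eq] at h
  exact ContinuousLinearMap.isSelfAdjoint_iff_isSymmetric.1 h.symm

variable [Group.FG Γ]

/-- The functional `y ↦ E[ntr π_N(y)]` on the group algebra. -/
def expectNtr (Γ : Type*) [Group Γ] [Group.FG Γ] (N : ℕ) : MonoidAlgebra ℂ Γ →ₗ[ℂ] ℂ where
  toFun y := expectHom fun φ : Γ →* Equiv.Perm (Fin N) => ntr (stdRepAlg φ y)
  map_add' y z := by
    simp only [expectHom, ntr, map_add, ContinuousLinearMap.toLinearMap_add, add_div,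
      Finset.sum_add_distrib]
  map_smul' c y := by
    simp only [expectHom, ntr, map_smul, ContinuousLinearMap.toLinearMap_smul, smul_eq_mul,
      RingHom.id_apply, mul_div_assoc, ← Finset.mul_sum]

theorem expectNtr_single (N : ℕ) (γ : Γ) :
    expectNtr Γ N (MonoidAlgebra.single γ 1) =
      expectHom fun φ : Γ →* Equiv.Perm (Fin N) => ntr (stdRep φ γ) := by
  simp [expectNtr, stdRepAlg]

theorem norm_expectNtr_sub_le {μ : ℕ} {u : ℕ → Γ → ℝ} {C : ℝ} {s N : ℕ}
    {y : MonoidAlgebra ℂ Γ}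
    (h : ∀ γ ∈ y.coeff.support,
      ‖expectHom (fun φ : Γ →* Equiv.Perm (Fin N) => ntr (stdRep φ γ)) -
          ((∑ k ∈ Finset.range s, u k γ / (N : ℝ) ^ ((k : ℝ) / (μ : ℝ)) : ℝ) : ℂ)‖ ≤ C) :
    ‖expectNtr Γ N y - ∑ k ∈ Finset.range s, (rootInv μ N ^ k : ℝ) • linExt (u k) y‖ ≤
      ellOne y * C := by
  have h2 := norm_map_le_ellOne (expectNtr Γ N -
    ∑ k ∈ Finset.range s, ((rootInv μ N ^ k : ℝ) : ℂ) • linExt (u k)) y (B := C) ?_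
  · simpa using h2
  · intro γ hγ
    refine le_of_eq_of_le ?_ (h γ hγ)
    congr 1
    rw [LinearMap.sub_apply, expectNtr_single, LinearMap.sum_apply, Complex.ofReal_sum]
    congr 1
    refine Finset.sum_congr rfl fun k _ => ?_
    rw [LinearMap.smul_apply, linExt_single, one_mul, rootInv_pow, smul_eq_mul, ← Complex.ofReal_mul,
      inv_mul_eq_div]

theorem finrank_stdSpace_le (N : ℕ) : Module.finrank ℂ (StdSpace N) ≤ N :=
  (Submodule.finrank_le _).trans (by simp)

/-- Markov's inequality for the nonnegative trace of f(π_N(x))^L, which is at least 2^{-L} on the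
bad event; the factor N undoes the normalization. -/
theorem exists_expectNtr_eq {x : MonoidAlgebra ℂ Γ} (hx : IsSelfAdj x) {a K : ℝ} (ha : 0 < a)
    (hK : ellOne x ≤ K) {f : Polynomial ℝ} (hf : ∀ t, |t| ≤ K → 0 ≤ f.eval t ∧ f.eval t ≤ 1)
    (hfa : ∀ t, a ≤ |t| → |t| ≤ K → 1 / 2 ≤ f.eval t) (L N : ℕ) :
    ∃ e : ℝ, expectNtr Γ N (aeval x (f.map (algebraMap ℝ ℂ)) ^ L) = e ∧ 0 ≤ e ∧ e ≤ 1 ∧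
      (0 < N → probHom (fun φ : Γ →* Equiv.Perm (Fin N) => a < ‖stdRepAlg φ x‖) ≤
        2 ^ L * N * e) := by
  have hex := fun φ : Γ →* Equiv.Perm (Fin N) => exists_trace_aeval_pow_eq
    (isSymmetric_stdRepAlg φ hx) ha ((norm_lift_le_ellOne (norm_stdRep_apply φ) x).trans hK)
    hf hfa L
  choose T hT hT0 hTN hTa using hex
  set n : ℕ := Fintype.card (Γ →* Equiv.Perm (Fin N)) with hn
  have hnpos : (0 : ℝ) < n := by
    have : 0 < n := Fintype.card_pos
    exact_mod_cast this
  refine ⟨(∑ φ, T φ / N) / n, ?_, ?_, ?_, ?_⟩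
  · change expectHom _ = _
    rw [expectHom]
    push_cast
    congr 1
    refine Finset.sum_congr rfl fun φ _ => ?_
    rw [ntr, map_pow, ← Polynomial.aeval_algHom_apply, hT φ]
  · exact div_nonneg (Finset.sum_nonneg fun φ _ => div_nonneg (hT0 φ) (Nat.cast_nonneg N))
      hnpos.le
  · rw [div_le_one hnpos]
    refine (Finset.sum_le_card_nsmul _ _ 1 fun φ _ => ?_).trans ?_
    · exact div_le_one_of_le₀ ((hTN φ).trans (by exact_mod_cast finrank_stdSpace_le N))
        (Nat.cast_nonneg N)
    · simp [hn]
  · intro hN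
    classical
    have hN' : (0 : ℝ) < N := by exact_mod_cast hN
    rw [probHom, Nat.card_eq_fintype_card (α := Γ →* Equiv.Perm (Fin N)), ← hn, mul_div_assoc',
      div_le_div_iff_of_pos_right hnpos, Nat.card_eq_fintype_card, Fintype.card_subtype,
      Finset.card_filter, Finset.mul_sum]
    push_cast
    refine Finset.sum_le_sum fun φ _ => ?_
    have h1 : 2 ^ L * (N : ℝ) * (T φ / N) = 2 ^ L * T φ := by field_simp
    rw [h1]
    split_ifs with h
    · have h2 := hTa φ h
      rw [one_div, inv_pow, inv_le_iff_one_le_mul₀ (by positivity)] at h2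
      linarith
    · exact mul_nonneg (by positivity) (hT0 φ)

end Expectation

end Representations

/-! ### The tail bound for self-adjoint elements -/

section TailBound

open Polynomial (aeval)

variable {Γ : Type*} [Group Γ] [Group.FG Γ]

theorem eventually_mul_rootInv_le_one {μ : ℕ} (hμ : 1 ≤ μ) {Q : ℕ → ℝ} (hQ : IsSubpolynomial Q) :
    ∀ᶠ N : ℕ in atTop, Q N * rootInv μ N ≤ 1 := by
  have hμ0 : (0 : ℝ) < μ := by exact_mod_cast hμ
  have h := hQ.tendsto_mul_rpow_neg (δ := 1 / (μ : ℝ)) (by positivity)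
  filter_upwards [h.eventually_le_const zero_lt_one] with N hN
  rwa [Real.rpow_neg (Nat.cast_nonneg N)] at hN

theorem mul_rootInv_le_one {μ : ℕ} (hμ : 1 ≤ μ) {G : ℝ} (hG : 0 ≤ G) {M : ℕ} (hM : 0 < M)
    (h : G ^ μ ≤ M) : G * rootInv μ M ≤ 1 := by
  have hM' : (0 : ℝ) < M := by exact_mod_cast hM
  have hμ0 : (μ : ℝ) ≠ 0 := by exact_mod_cast (by omega : μ ≠ 0)
  rw [rootInv, ← div_eq_mul_inv, div_le_one (by positivity)]
  calc G = (G ^ μ) ^ (1 / (μ : ℝ)) := by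
        rw [← Real.rpow_natCast, ← Real.rpow_mul hG, mul_one_div_cancel hμ0, Real.rpow_one]
    _ ≤ (M : ℝ) ^ (1 / (μ : ℝ)) := Real.rpow_le_rpow (by positivity) h (by positivity)

theorem inv_rootInv_le {μ : ℕ} (hμ : 1 ≤ μ) {M : ℕ} (hM : 0 < M) : (rootInv μ M)⁻¹ ≤ M := by
  have hM' : (1 : ℝ) ≤ M := by exact_mod_cast hM
  have hμ' : (1 : ℝ) ≤ μ := by exact_mod_cast hμ
  rw [rootInv, inv_inv]
  conv_rhs => rw [← Real.rpow_one (M : ℝ)]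
  exact Real.rpow_le_rpow_of_exponent_le hM' ((div_le_one (by linarith)).2 hμ')

/-- As L ≤ s and b ≥ 1, the ℓ¹ factor and the expansion error merge into a single s-th power, the
form required by `abs_sub_truncation_le`. -/
theorem mul_pow_expansionError_le {μ L s N : ℕ} {C b E : ℝ} (hC : 1 ≤ C) (hb : 1 ≤ b)
    (hLs : L ≤ s) (hN : 0 < N) (hE : E ≤ b ^ L) :
    E * ((C * s) ^ (C * s) / (N : ℝ) ^ ((s : ℝ) / (μ : ℝ))) ≤
      (b * (C * s) ^ C * rootInv μ N) ^ s := by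
  have hN' : (0 : ℝ) < N := by exact_mod_cast hN
  have hCs : 0 ≤ C * s := mul_nonneg (by linarith) (Nat.cast_nonneg s)
  rw [mul_pow, mul_pow, rootInv_pow, ← div_eq_mul_inv, mul_div_assoc, ← Real.rpow_natCast ((C * s) ^ C),
    ← Real.rpow_mul hCs]
  refine mul_le_mul_of_nonneg_right (hE.trans (pow_le_pow_right₀ hb hLs)) (by positivity)

/-- The tail bound for the norm of a self-adjoint element of the group algebra. -/
theorem eventually_probHom_le {S : Finset Γ} (hS : IsSymmGenSet S) {μ : ℕ} (hμ : 1 ≤ μ)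
    {u : ℕ → Γ → ℝ} (hexp : HasTraceExpansion S μ u) {x : MonoidAlgebra ℂ Γ} (hx : IsSelfAdj x)
    (htemp : ∀ k : ℕ, 1 ≤ k → k ≤ μ → IsTemperedAt (linExt (u k)) x) {a : ℝ}
    (ha : ‖leftRegularAlg Γ x‖ < a) :
    ∀ᶠ N : ℕ in atTop,
      probHom (fun φ : Γ →* Equiv.Perm (Fin N) => a < ‖stdRepAlg φ x‖) ≤
        (N : ℝ) ^ (-(1 / (2 * (μ : ℝ)))) := by
  obtain ⟨hu0, C, hC, hexp⟩ := hexp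
  obtain ⟨r, hxr, hra⟩ := exists_between ha
  have hr0 : 0 < r := (norm_nonneg _).trans_lt hxr
  have ha0 : 0 < a := hr0.trans hra
  have hex : ∀ k, ∃ c : ℝ, 0 ≤ c ∧ (k ≤ μ → ∀ p, ‖linExt (u k) (x ^ p)‖ ≤ c * r ^ p) := by
    intro k
    rcases Nat.eq_zero_or_pos k with rfl | hk
    · exact ⟨1, zero_le_one, fun _ p => norm_linExt_pow_le hu0 hxr.le p⟩
    · by_cases hkμ : k ≤ μ
      · obtain ⟨c, hc0, hc⟩ := (htemp k hk hkμ).exists_norm_pow_le hxr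
        exact ⟨c, hc0, fun _ => hc⟩
      · exact ⟨0, le_rfl, fun h => absurd h hkμ⟩
  choose c hc0 hc using hex
  -- With L ≥ log N/(8μ), this value makes θ^L ≤ N^{-2}.
  set θ : ℝ := Real.exp (-(16 * μ)) with hθ
  have hθ0 : 0 < θ := Real.exp_pos _
  have hθ1 : θ ≤ 1 := Real.exp_le_one_iff.2 (by simp)
  -- The ℓ¹ norm bounds ‖π_N(x)‖ for every homomorphism; the maximum with a only secures a ≤ K.
  obtain ⟨f, hf, hfa, hfr⟩ := exists_cutoff_polynomial hr0 hra (le_max_right (ellOne x) a) hθ0 hθ1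
  set y : MonoidAlgebra ℂ Γ := aeval x (f.map (algebraMap ℝ ℂ)) with hy
  set b : ℝ := max (ellOne y) 1 with hb
  have hb1 : 1 ≤ b := le_max_right _ _
  -- The extra 1 makes n positive, hence L ≤ nL ≤ s.
  set n : ℕ := y.coeff.support.sup (wordLength S) + 1 with hn
  have hyn : ∀ γ ∈ y.coeff.support, wordLength S γ ≤ n := fun γ hγ =>
    (Finset.le_sup hγ).trans (Nat.le_succ _)
  set s : ℕ → ℕ := expansionLength μ n with hs
  set M₀ : ℕ → ℕ := fun N => threshold μ C b (s N) with hM₀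
  set Q : ℕ → ℝ := fun N => 4 * (s N : ℝ) ^ 2 * M₀ N with hQ
  have hQsub : IsSubpolynomial Q :=
    ((IsSubpolynomial.const 4).mul ((isSubpolynomial_expansionLength μ n).pow 2)).mul
      (isSubpolynomial_threshold μ n hC hb1)
  set D : ℝ := ∑ k ∈ Finset.range (μ + 1), c k with hD
  have hD0 : 0 ≤ D := Finset.sum_nonneg fun k _ => hc0 k
  filter_upwards [eventually_error_le hμ D hD0 (fun N => by positivity) hQsub,
    eventually_mul_rootInv_le_one hμ hQsub, eventually_gt_atTop 0] with N herr hQN hN0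
  set L := cutoffPower μ N with hL
  have hsL : s N = n * L + μ + 1 := rfl
  have hs1 : 1 ≤ s N := by omega
  have hs1' : (1 : ℝ) ≤ s N := by exact_mod_cast hs1
  have hLs : L ≤ s N := by
    have : L ≤ n * L := Nat.le_mul_of_pos_left L (by omega)
    omega
  set G : ℝ := b * (C * s N) ^ C with hG
  have hCs1 : 1 ≤ C * s N := by nlinarith
  have hG1 : 1 ≤ G := by
    have : 1 ≤ (C * s N) ^ C := Real.one_le_rpow hCs1 (by linarith)
    nlinarith
  -- The three summands provide, in order, the spacing condition for the Markov argument, the range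
  -- of validity of the expansion, and G M₀^{-1/μ} ≤ 1.
  have hM₀le : 8 * (s N : ℝ) ^ 2 + C * (s N : ℝ) ^ C + G ^ μ ≤ M₀ N := Nat.le_ceil _
  have hCsC : 0 ≤ C * (s N : ℝ) ^ C := by positivity
  have hGμ : 0 ≤ G ^ μ := by positivity
  have h8 : 8 * (s N) ^ 2 ≤ M₀ N := by
    have : 8 * (s N : ℝ) ^ 2 ≤ M₀ N := by linarith
    exact_mod_cast this
  have hM₀pos : 0 < M₀ N := lt_of_lt_of_le (by positivity) h8
  have hM₀pos' : (0 : ℝ) < M₀ N := by exact_mod_cast hM₀pos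
  -- L and s stay at their values for N while M varies, so that the approximating polynomial in
  -- M^{-1/μ} has fixed coefficients.
  choose e he he0 he1 hprob using
    fun M => exists_expectNtr_eq hx ha0 (le_max_left (ellOne x) a) hf hfa L M
  set p : ℕ → ℝ := fun k => (linExt (u k) (y ^ L)).re with hp
  have happ : ∀ M, M₀ N ≤ M → |e M - ∑ k ∈ Finset.range (s N), p k * rootInv μ M ^ k| ≤
      (G * rootInv μ M) ^ s N := by
    intro M hM
    have hMpos : 0 < M := hM₀pos.trans_le hM
    have hM' : (M₀ N : ℝ) ≤ M := by exact_mod_cast hM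
    have h1 := norm_expectNtr_sub_le (y := y ^ L) fun γ hγ =>
      hexp γ (s N) hs1 ((wordLength_le_of_mem_support_pow hS hyn L γ hγ).trans (by omega)) M
        (by nlinarith [sq_nonneg (s N : ℝ)])
    have h2 := (Complex.abs_re_le_norm _).trans h1
    rw [he M] at h2
    simp only [Complex.sub_re, Complex.ofReal_re, Complex.re_sum, Complex.smul_re,
      smul_eq_mul] at h2
    simp only [hp, mul_comm _ (rootInv μ M ^ _)]
    refine h2.trans (mul_pow_expansionError_le hC hb1 hLs hMpos ?_)
    exact (ellOne_pow_le y L).trans (pow_le_pow_left₀ (ellOne_nonneg y) (le_max_left _ _) L)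
  have htN : 0 < rootInv μ N := rootInv_pos μ hN0
  have ht0 : 0 < rootInv μ (M₀ N) := rootInv_pos μ hM₀pos
  have hinv := inv_rootInv_le hμ hM₀pos
  have hHN : 4 * (s N : ℝ) ^ 2 * rootInv μ N ≤ rootInv μ (M₀ N) := by
    have h1 : 4 * (s N : ℝ) ^ 2 * rootInv μ N ≤ (M₀ N : ℝ)⁻¹ := by
      rw [← one_div, le_div_iff₀ hM₀pos']
      calc 4 * (s N : ℝ) ^ 2 * rootInv μ N * M₀ N = Q N * rootInv μ N := by simp only [hQ]; ring
        _ ≤ 1 := hQN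
    exact h1.trans ((inv_le_comm₀ ht0 hM₀pos').1 hinv)
  have hNM : M₀ N ≤ N := by
    have h1 : (M₀ N : ℝ) * rootInv μ N ≤ 1 := by
      refine le_trans (mul_le_mul_of_nonneg_right ?_ htN.le) hQN
      simp only [hQ]
      exact le_mul_of_one_le_left hM₀pos'.le (by nlinarith)
    rw [← le_div_iff₀ htN, one_div] at h1
    exact_mod_cast h1.trans (inv_rootInv_le hμ hN0)
  have hmain := abs_sub_truncation_le hμ (by omega) hG1 h8
    (mul_rootInv_le_one hμ (by linarith) hM₀pos (by nlinarith [sq_nonneg (s N : ℝ)]))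
    (fun M => by rw [abs_of_nonneg (he0 M)]; exact he1 M) happ hNM hHN
  have hpk : ∀ k ∈ Finset.range (μ + 1), p k * rootInv μ N ^ k ≤ c k * θ ^ L := by
    intro k hk
    have h1 := norm_map_aeval_le (hc k (Nat.lt_succ_iff.1 (Finset.mem_range.1 hk))) (f ^ L)
    rw [Polynomial.map_pow, map_pow, ← hy] at h1
    have h2 : |p k| ≤ c k * θ ^ L := by
      refine ((Complex.abs_re_le_norm _).trans h1).trans (mul_le_mul_of_nonneg_left ?_ (hc0 k))
      exact (coeffNorm_pow_le hr0.le f L).trans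
        (pow_le_pow_left₀ (coeffNorm_nonneg hr0.le f) hfr L)
    have h3 : rootInv μ N ^ k ≤ 1 := pow_le_one₀ htN.le (by
      have := rootInv_anti μ one_pos hN0
      simpa [rootInv] using this)
    calc p k * rootInv μ N ^ k ≤ |p k| * 1 :=
          mul_le_mul (le_abs_self _) h3 (by positivity) (abs_nonneg _)
      _ ≤ c k * θ ^ L := by rwa [mul_one]
  have hsum : ∑ k ∈ Finset.range (μ + 1), p k * rootInv μ N ^ k ≤ D * θ ^ L :=
    (Finset.sum_le_sum hpk).trans (by rw [hD, Finset.sum_mul])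
  have hQle : 2 * (s N : ℝ) ^ 2 / rootInv μ (M₀ N) * rootInv μ N ≤ Q N * rootInv μ N := by
    refine mul_le_mul_of_nonneg_right ?_ htN.le
    rw [div_eq_mul_inv]
    exact mul_le_mul (by nlinarith [sq_nonneg (s N : ℝ)]) hinv (by positivity) (by positivity)
  have hpowle := pow_le_pow_left₀ (by positivity) hQle (μ + 1)
  have heN : e N ≤ D * θ ^ L + 9 * (Q N * rootInv μ N) ^ (μ + 1) := by
    have := (le_abs_self _).trans hmain
    linarith
  exact (hprob N hN0).trans ((mul_le_mul_of_nonneg_left heN (by positivity)).trans herr)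

theorem probHom_mono {N : ℕ} {A B : (Γ →* Equiv.Perm (Fin N)) → Prop} (h : ∀ φ, A φ → B φ) :
    probHom A ≤ probHom B := by
  unfold probHom
  have := Nat.card_mono (Set.toFinite {φ | B φ}) (s := {φ | A φ}) h
  gcongr
  exact this

theorem probHom_nonneg {N : ℕ} (A : (Γ →* Equiv.Perm (Fin N)) → Prop) : 0 ≤ probHom A := by
  unfold probHom; positivity

end TailBound

end StrongUpperBound

end

/-! ### Reduction of the general case to self-adjoint elements -/

theorem theorem1p2 {Γ : Type*} [Group Γ] [Group.FG Γ]
    (S : Finset Γ) (hS : StrongUpperBound.IsSymmGenSet S)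
    (μ : ℕ) (hμ : 1 ≤ μ) (u : ℕ → Γ → ℝ)
    (hexp : StrongUpperBound.HasTraceExpansion S μ u)
    (htemp : ∀ k : ℕ, 1 ≤ k → k ≤ μ → ∀ x : MonoidAlgebra ℂ Γ,
      StrongUpperBound.IsSelfAdj x →
        StrongUpperBound.IsTemperedAt (StrongUpperBound.linExt (u k)) x)
    (x : MonoidAlgebra ℂ Γ) :
    ∃ ε : ℕ → ℝ, Tendsto ε atTop (𝓝 0) ∧
      (fun N : ℕ => StrongUpperBound.probHom
        (fun φ : Γ →* Equiv.Perm (Fin N) =>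
          ‖StrongUpperBound.leftRegularAlg Γ x‖ + ε N < ‖StrongUpperBound.stdRepAlg φ x‖))
        =O[atTop] (fun N : ℕ => (N : ℝ) ^ (-(1 / (2 * (μ : ℝ))))) := by
  open StrongUpperBound in
  obtain ⟨ε, hε, hP⟩ := exists_tendsto_zero_of_forall_eventually
    (P := fun ε N => probHom (fun φ : Γ →* Equiv.Perm (Fin N) =>
      ‖leftRegularAlg Γ x‖ + ε < ‖stdRepAlg φ x‖))
    (g := fun N : ℕ => (N : ℝ) ^ (-(1 / (2 * (μ : ℝ))))) (by
      intro ε hε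
      have hz := isSelfAdj_involution_mul_self x
      have hlam : ‖leftRegularAlg Γ (involution x * x)‖ = ‖leftRegularAlg Γ x‖ ^ 2 :=
        norm_lift_involution_mul_self norm_leftRegular_apply x
      -- The level ‖λ(x)‖² + ε² suffices for `involution x * x`, since (‖λ(x)‖ + ε)² is at least
      -- that large.
      filter_upwards [eventually_probHom_le hS hμ hexp hz (fun k h1 h2 => htemp k h1 h2 _ hz)
        (lt_add_of_pos_right _ (pow_pos hε 2))] with N hN
      refine (probHom_mono fun φ hφ => ?_).trans hN
      have hpi : ‖stdRepAlg φ (involution x * x)‖ = ‖stdRepAlg φ x‖ ^ 2 :=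
        norm_lift_involution_mul_self (norm_stdRep_apply φ) x
      rw [hlam, hpi]
      have hnn := norm_nonneg (leftRegularAlg Γ x)
      nlinarith [mul_nonneg hnn hε.le])
  refine ⟨ε, hε, IsBigO.of_bound 1 ?_⟩
  filter_upwards [hP] with N hN
  rw [one_mul, Real.norm_of_nonneg (StrongUpperBound.probHom_nonneg _),
    Real.norm_of_nonneg (by positivity)]
  exact hN
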